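/- Let $a,\nu,\gamma$ be real numbers with $\gamma>0$ and $a^2\le\nu$. (These are exactly the parameters that arise as $a=\mathbb E[\xi k(\xi)]$, $\nu=\mathbb E[k(\xi)^2]$ for $\xi\sim\mathcal N(0,1)$ and a kernel function $k$ with $\mathbb E[k(\xi)]=0$ and $\mathbb E[k(\xi)^2]<\infty$.) Write $\mathbb C^+=\{z\in\mathbb C:\operatorname{Im} z>0\}$. The Cheng–Singer limit measure $\mu_{a,\nu,\gamma}$ is the probability measure on $\mathbb R$ whose Stieltjes transform $m(z)=\int (x-z)^{-1}\,\mu_{a,\nu,\gamma}(dx)$ maps $\mathbb C^+$ to $\mathbb C^+$ and is, for every $z\in\mathbb C^+$, the unique solution in $\mathbb C^+$ of $$-\frac1{m(z)}=z+a\left(1-\frac1{1+a\gamma m(z)}\right)+\gamma(\nu-a^2)\,m(z).$$ Let $\mu_{\mathrm{sc}}$ be the semicircle law, with density $\frac1{2\pi}\sqrt{4-x^2}$ on $[-2,2]$, and let $\sqrt{\gamma(\nu-a^2)}\,\mu_{\mathrm{sc}}$ denote the law of $\sqrt{\gamma(\nu-a^2)}\,y$ for $y\sim\mu_{\mathrm{sc}}$.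 Let $\mu_{\mathrm{MP},\gamma}$ be the standard Marchenko–Pastur law, which is the sum of $\max(1-1/\gamma,0)\,\delta_0$ and the measure with density $\frac{\sqrt{(\lambda_+-x)(x-\lambda_-)}}{2\pi\gamma x}$ on $[\lambda_-,\lambda_+]$, where $\lambda_\pm=(1\pm\sqrt\gamma)^2$, and let $a(\mu_{\mathrm{MP},\gamma}-1)$ denote the law of $a(y-1)$ for $y\sim\mu_{\mathrm{MP},\gamma}$. For compactly supported probability measures $\mu_1,\mu_2$ on $\mathbb R$, let $\mu_1\boxplus\mu_2$ denote their additive free convolution in the sense of Voiculescu, that is, the law of $x+y$, where $x$ and $y$ are freely independent self-adjoint elements of a $C^*$-probability space with laws $\mu_1$ and $\mu_2$ respectively. Then $\mu_{a,\nu,\gamma}$ exists and is unique, the free convolution below exists and is unique, and $$\mu_{a,\nu,\gamma}=a(\mu_{\mathrm{MP},\gamma}-1)\boxplus\sqrt{\gamma(\nu-a^2)}\,\mu_{\mathrm{sc}}.$$ -/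

import Mathlib

universe u

/-! ### Stieltjes transforms and the Cheng–Singer limit measure -/

/-- The Stieltjes transform of a measure on `ℝ`, that is `m(z) = ∫ (x - z)⁻¹ dμ(x)`
(see `stieltjesTransform_eq`). -/
noncomputable def stieltjesTransform (μ : MeasureTheory.Measure ℝ) (z : ℂ) : ℂ :=
  MeasureTheory.resolventTransform μ z

theorem stieltjesTransform_eq (μ : MeasureTheory.Measure ℝ) (z : ℂ) :
    stieltjesTransform μ z = ∫ x : ℝ, ((x : ℂ) - z)⁻¹ ∂μ := by
  simp [stieltjesTransform, MeasureTheory.resolventTransform_apply, resolvent]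

/-- The equation `-1/m = z + a (1 - 1/(1 + aγm)) + γ(ν - a²) m`. When `z` and `m` have positive
imaginary part, `m` and `1 + aγm` are both nonzero. -/
def ChengSingerEquation (a ν γ : ℝ) (z m : ℂ) : Prop :=
  -(1 / m) = z + (a : ℂ) * (1 - 1 / (1 + (a : ℂ) * (γ : ℂ) * m))
    + (γ : ℂ) * ((ν : ℂ) - (a : ℂ) ^ 2) * m

/-- `μ` is the Cheng–Singer limit measure `μ_{a,ν,γ}`: a probability measure on `ℝ` whose Stieltjes
transform maps the open upper half plane to itself and is, at each point `z` of it, the unique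
solution with positive imaginary part of the Cheng–Singer equation. -/
structure IsChengSingerMeasure (a ν γ : ℝ) (μ : MeasureTheory.Measure ℝ) : Prop where
  isProbabilityMeasure : MeasureTheory.IsProbabilityMeasure μ
  im_pos : ∀ z : ℂ, 0 < z.im → 0 < (stieltjesTransform μ z).im
  equation : ∀ z : ℂ, 0 < z.im → ChengSingerEquation a ν γ z (stieltjesTransform μ z)
  unique : ∀ z : ℂ, 0 < z.im → ∀ w : ℂ, 0 < w.im → ChengSingerEquation a ν γ z w →
    w = stieltjesTransform μ z

/-! ### The semicircle and Marchenko–Pastur laws -/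

/-- The semicircle law on `[-2, 2]`, with density `√(4 - x²) / (2π)` there. -/
noncomputable def semicircleLaw : MeasureTheory.Measure ℝ :=
  (MeasureTheory.volume.restrict (Set.Icc (-2 : ℝ) 2)).withDensity
    fun x => ENNReal.ofReal (Real.sqrt (4 - x ^ 2) / (2 * Real.pi))

/-- The standard Marchenko–Pastur law with ratio `γ` (the limiting spectral measure of `n⁻¹XXᵀ`
for `X` a `p × n` matrix with i.i.d. entries of mean `0` and variance `1` and `p/n → γ`):
an atom of mass `max (1 - 1/γ) 0` at `0`, plus the density
`√((λ₊ - x)(x - λ₋)) / (2πγx)` on `[λ₋, λ₊]`, where `λ± = (1 ± √γ)²`. -/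
noncomputable def marchenkoPasturLaw (γ : ℝ) : MeasureTheory.Measure ℝ :=
  ENNReal.ofReal (1 - 1 / γ) • MeasureTheory.Measure.dirac 0
    + (MeasureTheory.volume.restrict
        (Set.Icc ((1 - Real.sqrt γ) ^ 2) ((1 + Real.sqrt γ) ^ 2))).withDensity
      fun x => ENNReal.ofReal
        (Real.sqrt (((1 + Real.sqrt γ) ^ 2 - x) * (x - (1 - Real.sqrt γ) ^ 2))
          / (2 * Real.pi * γ * x))

/-! ### Free independence and additive free convolution -/

section FreeProbability

variable {A : Type u} [CStarAlgebra A]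

/-- A state on a unital C⋆-algebra: a unital positive linear functional.
A pair `(A, φ)` with `φ` a state on `A` is a C⋆-probability space. -/
structure IsState (φ : A →ₗ[ℂ] ℂ) : Prop where
  map_one : φ 1 = 1
  nonneg_re : ∀ x : A, 0 ≤ (φ (star x * x)).re
  im_eq_zero : ∀ x : A, (φ (star x * x)).im = 0

/-- Free independence of a family of unital subalgebras with respect to `φ`: `φ(x₁ x₂ ⋯ xₙ) = 0`
for all `n ≥ 1` whenever `φ(xⱼ) = 0` and `xⱼ ∈ B (iⱼ)` for all `j`, and `iⱼ ≠ iⱼ₊₁` for all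
`j < n`. -/
def AreFree {ι : Type*} (φ : A →ₗ[ℂ] ℂ) (B : ι → Subalgebra ℂ A) : Prop :=
  ∀ l : List (ι × A), l ≠ [] →
    (l.map Prod.fst).IsChain (fun i j => i ≠ j) →
    (∀ p ∈ l, p.2 ∈ B p.1 ∧ φ p.2 = 0) →
    φ (l.map Prod.snd).prod = 0

/-- Two self-adjoint elements are free if the unital (automatically star-closed) subalgebras that
they generate are free. -/
def AreFreeElements (φ : A →ₗ[ℂ] ℂ) (x y : A) : Prop :=
  AreFree φ ![Algebra.adjoin ℂ {x}, Algebra.adjoin ℂ {y}]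

/-- The self-adjoint element `x` of the C⋆-probability space `(A, φ)` has law `μ`: `μ` is the
(unique) compactly supported probability measure on `ℝ` with the same moments as `x`. -/
structure HasSpectralLaw (φ : A →ₗ[ℂ] ℂ) (x : A) (μ : MeasureTheory.Measure ℝ) : Prop where
  isSelfAdjoint : IsSelfAdjoint x
  isProbabilityMeasure : MeasureTheory.IsProbabilityMeasure μ
  isCompact_support : IsCompact μ.support
  moment : ∀ n : ℕ, φ (x ^ n) = ((∫ t : ℝ, t ^ n ∂μ : ℝ) : ℂ)

end FreeProbability

/-- `μ = μ₁ ⊞ μ₂` for compactly supported probability measures `μ₁`, `μ₂` on `ℝ`, in the sense of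
Voiculescu: `μ` is the law of `x + y`, where `x` and `y` are free self-adjoint elements of some
C⋆-probability space with laws `μ₁` and `μ₂`. -/
def IsFreeConvolution (μ₁ μ₂ μ : MeasureTheory.Measure ℝ) : Prop :=
  ∃ (A : Type u) (_ : CStarAlgebra A) (φ : A →ₗ[ℂ] ℂ) (x y : A),
    IsState φ ∧ AreFreeElements φ x y ∧
      HasSpectralLaw φ x μ₁ ∧ HasSpectralLaw φ y μ₂ ∧ HasSpectralLaw φ (x + y) μ

/-!
# The Cheng–Singer law as a free convolution

Everything is read off from one explicit model. On the full Fock space `ℓ²(List (Fin 2))` with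
vacuum `Ω` and creation operators `l₀`, `l₁`, put `σ² = γ (ν - a²)` and

  `x = a (√γ (l₀ + l₀⋆) + γ l₀ l₀⋆) = a ((1 + √γ l₀) (1 + √γ l₀⋆) - 1)`, `y = σ (l₁ + l₁⋆)`.

* In the vacuum state, `y` has the law of `σ` times a semicircular variable, because the Chebyshev
  polynomials `S n` satisfy `S n (l + l⋆) Ω = lⁿ Ω` and are orthogonal to `1` for the semicircle
  law. The element `(1 + √γ l) (1 + √γ l⋆)` has the Marchenko–Pastur law: exchanging the factors
  gives `1 + γ + √γ (l + l⋆)`, which corresponds to the fact that `t dMP(t)` is an affine image of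
  the semicircle law. That the explicit Marchenko–Pastur law has total mass one comes from the
  integral of the Poisson kernel.
* `x` and `y` are free, because a centered polynomial in `x` maps the kernel of `l₀⋆` into the
  range of `l₀`, and similarly for `y` (`IsFockRepresentation.areFree`).
* Let `m = ⟪Ω, (x + y - z)⁻¹ Ω⟫`. Commuting `x + y - z` with the creation operators that append a
  letter on the right shows that `m` solves the Cheng–Singer equation
  (`IsFockRepresentation.vacuum_resolvent_equation`). Conversely, from a solution `w` in the upper
  half plane one builds the vector `w (1 - t₀ l₀ - t₁ l₁)⁻¹ Ω`, which solves `(x + y - z) u = Ω`;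
  the imaginary part of the equation says exactly that `|t₀|² + |t₁|² < 1`. So `w = m`
  (`IsFockRepresentation.eq_vacuum_resolvent`), and the solution is unique.

Hence the law of `x + y` is a Cheng–Singer measure. It is the only one, since a probability measure
is determined by its Stieltjes transform (`ext_of_stieltjesTransform`). It is the only free
convolution, since freeness determines the moments of a sum (`AreFreeElements.moment_add_eq`) and
the moments determine a compactly supported law (`MeasureTheory.Measure.ext_of_moments`).
-/

open scoped InnerProductSpace

/-! ### The full Fock space -/

section Fock

variable {H : Type*} [NormedAddCommGroup H] [InnerProductSpace ℂ H] [CompleteSpace H]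

/-- The operators `l i` and `r i` on `H` satisfy the relations of the left and right creation
operators of a full Fock space with vacuum vector `Ω`. The last field says that the left
annihilation operators commute with the right creation operators up to the vacuum projection. -/
structure IsFockRepresentation {κ : Type*} [DecidableEq κ] (l r : κ → H →L[ℂ] H) (Ω : H) :
    Prop where
  norm_vacuum : ‖Ω‖ = 1
  star_left_mul_left : ∀ i j, star (l i) * l j = if i = j then 1 else 0
  star_left_vacuum : ∀ i, star (l i) Ω = 0
  star_right_vacuum : ∀ i, star (r i) Ω = 0
  right_vacuum : ∀ i, r i Ω = l i Ω
  left_mul_right : ∀ i j, l i * r j = r j * l i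
  star_left_right : ∀ i j v,
    star (l i) (r j v) = r j (star (l i) v) + if i = j then ⟪Ω, v⟫_ℂ • Ω else 0

theorem ContinuousLinearMap.star_inner_right (T : H →L[ℂ] H) (v w : H) :
    ⟪v, star T w⟫_ℂ = ⟪T v, w⟫_ℂ := by
  rw [ContinuousLinearMap.star_eq_adjoint, ContinuousLinearMap.adjoint_inner_right]

theorem ContinuousLinearMap.star_inner_left (T : H →L[ℂ] H) (v w : H) :
    ⟪star T v, w⟫_ℂ = ⟪v, T w⟫_ℂ := by
  rw [ContinuousLinearMap.star_eq_adjoint, ContinuousLinearMap.adjoint_inner_left]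

/-- An injection of the index set of a total orthonormal family is implemented by a bounded
operator. -/
theorem Orthonormal.exists_clm_apply {ι : Type*} {e : ι → H} (he : Orthonormal ℂ e)
    (hd : Dense (Submodule.span ℂ (Set.range e) : Set H)) {f : ι → ι}
    (hf : Function.Injective f) : ∃ S : H →L[ℂ] H, ∀ i, S (e i) = e (f i) := by
  classical
  have hd' : ⊤ ≤ (Submodule.span ℂ (Set.range e)).topologicalClosure := by
    rw [Submodule.dense_iff_topologicalClosure_eq_top.1 hd]
  let b := HilbertBasis.mk he hd'
  have hef : Orthonormal ℂ (e ∘ f) := he.comp f hf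
  refine ⟨(hef.orthogonalFamily.linearIsometry).toContinuousLinearMap ∘L
    b.repr.toContinuousLinearEquiv.toContinuousLinearMap, fun i => ?_⟩
  have : b i = e i := by simp [b]
  rw [← this]
  simp only [ContinuousLinearMap.comp_apply, LinearIsometry.coe_toContinuousLinearMap,
    ContinuousLinearEquiv.coe_coe, LinearIsometryEquiv.coe_toContinuousLinearEquiv]
  rw [b.repr_self, OrthogonalFamily.linearIsometry_apply_single]
  simp

theorem eq_of_forall_inner_eq_of_dense_span {E : Type*} [NormedAddCommGroup E]
    [InnerProductSpace ℂ E] {ι : Type*} {e : ι → E}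
    (hd : Dense (Submodule.span ℂ (Set.range e) : Set E)) {v w : E}
    (h : ∀ i, ⟪e i, v⟫_ℂ = ⟪e i, w⟫_ℂ) : v = w := by
  refine hd.eq_of_inner_right (𝕜 := ℂ) fun x hx => ?_
  induction hx using Submodule.span_induction with
  | mem x hx => obtain ⟨i, rfl⟩ := hx; exact h i
  | zero => simp
  | add x y _ _ hx hy => rw [inner_add_left, inner_add_left, hx, hy]
  | smul c x _ hx => rw [inner_smul_left, inner_smul_left, hx]

/-- The full Fock space `ℓ²(List κ)`: left creation operators prepend a letter to a word, right
creation operators append one, and the vacuum is the empty word. -/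
theorem exists_isFockRepresentation (κ : Type) [DecidableEq κ] :
    ∃ (H : Type u) (_ : NormedAddCommGroup H) (_ : InnerProductSpace ℂ H) (_ : CompleteSpace H)
      (l r : κ → H →L[ℂ] H) (Ω : H), IsFockRepresentation l r Ω := by
  let H : Type u := lp (fun _ : ULift.{u} (List κ) => ℂ) 2
  let b : HilbertBasis (ULift.{u} (List κ)) ℂ H := ⟨LinearIsometryEquiv.refl ℂ _⟩
  let e : List κ → H := fun w => b (ULift.up w)
  have he : Orthonormal ℂ e := b.orthonormal.comp _ ULift.up_injective
  have hd : Dense (Submodule.span ℂ (Set.range e) : Set H) := by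
    have : Set.range e = Set.range b :=
      ULift.up_surjective.range_comp b
    rw [this, Submodule.dense_iff_topologicalClosure_eq_top]
    exact b.dense_span
  have inner_e : ∀ v w, ⟪e v, e w⟫_ℂ = if v = w then 1 else 0 := orthonormal_iff_ite.1 he
  choose l hl using fun i : κ => he.exists_clm_apply hd (List.cons_injective (a := i))
  choose r hr using fun i : κ => he.exists_clm_apply hd (List.append_left_injective [i])
  have hl_nil : ∀ i, star (l i) (e []) = 0 := fun i =>
    eq_of_forall_inner_eq_of_dense_span hd fun w => by
      rw [ContinuousLinearMap.star_inner_right, hl, inner_e]; simp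
  have hl_cons : ∀ i j w, star (l i) (e (j :: w)) = if i = j then e w else 0 := fun i j w =>
    eq_of_forall_inner_eq_of_dense_span hd fun v => by
      rw [ContinuousLinearMap.star_inner_right, hl, inner_e]
      by_cases h : i = j <;> simp [h, inner_e]
  have ext_e : ∀ {S T : H →L[ℂ] H}, (∀ w, S (e w) = T (e w)) → S = T := fun h =>
    ContinuousLinearMap.ext_on hd fun _ ⟨w, hw⟩ => hw ▸ h w
  refine ⟨H, inferInstance, inferInstance, inferInstance, l, r, e [],
    ⟨he.norm_eq_one _, fun i j => ext_e fun w => ?_, hl_nil, fun i => ?_, fun i => ?_,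
      fun i j => ext_e fun w => ?_, fun i j v => ?_⟩⟩
  · rw [mul_apply_eq_comp, hl, hl_cons]
    split_ifs <;> simp
  · refine eq_of_forall_inner_eq_of_dense_span hd fun w => ?_
    rw [ContinuousLinearMap.star_inner_right, hr, inner_e]
    simp
  · rw [hr, hl]; rfl
  · simp only [mul_apply_eq_comp, hl, hr, List.cons_append]
  · have : star (l i) * r j =
        r j * star (l i) + if i = j then (innerSL ℂ (e [])).smulRight (e []) else 0 := by
      refine ext_e fun w => ?_
      rcases w with _ | ⟨k, w⟩
      · simp only [mul_apply_eq_comp, add_apply, hr, hl_nil,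
          List.nil_append, hl_cons]
        split_ifs <;> simp [he.1]
      · simp only [mul_apply_eq_comp, add_apply, hr,
          List.cons_append, hl_cons]
        split_ifs <;> simp [inner_e, hr]
    have h := congrArg (fun T : H →L[ℂ] H => T v) this
    simp only [mul_apply_eq_comp, add_apply] at h
    rw [h]
    split_ifs <;> simp

end Fock

/-! ### The vacuum state and freeness -/

section VacuumState

theorem ContinuousLinearMap.aeval_apply_eq_divX {E : Type*} [NormedAddCommGroup E]
    [NormedSpace ℂ E] (T : E →L[ℂ] E) (q : Polynomial ℂ) (ξ : E) :
    Polynomial.aeval T q ξ = T (Polynomial.aeval T q.divX ξ) + q.coeff 0 • ξ := by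
  have := congrArg (fun p => Polynomial.aeval T p ξ) (Polynomial.X_mul_divX_add q)
  simp only [map_add, map_mul, Polynomial.aeval_X, Polynomial.aeval_C] at this
  rw [← this]
  simp [Algebra.algebraMap_eq_smul_one]

variable {H : Type*} [NormedAddCommGroup H] [InnerProductSpace ℂ H] [CompleteSpace H]

/-- The linear functional `T ↦ ⟪Ω, T Ω⟫`. -/
noncomputable def vacuumState {E : Type*} [NormedAddCommGroup E] [InnerProductSpace ℂ E]
    (Ω : E) : (E →L[ℂ] E) →ₗ[ℂ] ℂ where
  toFun T := ⟪Ω, T Ω⟫_ℂ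
  map_add' S T := by simp
  map_smul' c T := by simp

theorem vacuumState_apply {E : Type*} [NormedAddCommGroup E] [InnerProductSpace ℂ E]
    (Ω : E) (T : E →L[ℂ] E) : vacuumState Ω T = ⟪Ω, T Ω⟫_ℂ := rfl

theorem isState_vacuumState {Ω : H} (hΩ : ‖Ω‖ = 1) : IsState (vacuumState Ω) := by
  have key : ∀ T : H →L[ℂ] H, vacuumState Ω (star T * T) = ((‖T Ω‖ ^ 2 : ℝ) : ℂ) := fun T => by
    rw [vacuumState_apply, mul_apply_eq_comp, ContinuousLinearMap.star_inner_right,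
      inner_self_eq_norm_sq_to_K]
    simp
  refine ⟨?_, fun T => ?_, fun T => ?_⟩
  · rw [vacuumState_apply, one_apply_eq_self, inner_self_eq_norm_sq_to_K, hΩ]
    simp
  · rw [key, Complex.ofReal_re]; positivity
  · rw [key, Complex.ofReal_im]

namespace IsFockRepresentation

variable {κ : Type*} [DecidableEq κ] {l r : κ → H →L[ℂ] H} {Ω : H}

theorem star_left_apply_left (h : IsFockRepresentation l r Ω) (i j : κ) (v : H) :
    star (l i) (l j v) = if i = j then v else 0 := by
  have := congrArg (fun T : H →L[ℂ] H => T v) (h.star_left_mul_left i j)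
  simp only [mul_apply_eq_comp] at this
  rw [this]
  split_ifs <;> simp

theorem inner_vacuum_left (h : IsFockRepresentation l r Ω) (i : κ) (v : H) :
    ⟪Ω, l i v⟫_ℂ = 0 := by
  rw [← ContinuousLinearMap.star_inner_left, h.star_left_vacuum, inner_zero_left]

theorem inner_vacuum_right (h : IsFockRepresentation l r Ω) (i : κ) (v : H) :
    ⟪Ω, r i v⟫_ℂ = 0 := by
  rw [← ContinuousLinearMap.star_inner_left, h.star_right_vacuum, inner_zero_left]

theorem inner_vacuum_vacuum (h : IsFockRepresentation l r Ω) : ⟪Ω, Ω⟫_ℂ = 1 := by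
  rw [inner_self_eq_norm_sq_to_K, h.norm_vacuum]; simp

/-- On the kernel of the annihilation operator `l i⋆`, a polynomial in the operator
`α (l i + l i⋆) + β l i l i⋆` acts as a polynomial in the creation operator `l i`. -/
theorem exists_polynomial_apply (h : IsFockRepresentation l r Ω) (i : κ) (α β : ℂ)
    {T : H →L[ℂ] H}
    (hT : T ∈ Algebra.adjoin ℂ {α • (l i + star (l i)) + β • (l i * star (l i))}) :
    ∃ q : Polynomial ℂ, ∀ ξ : H, star (l i) ξ = 0 → T ξ = Polynomial.aeval (l i) q ξ := by
  rw [Algebra.adjoin_singleton_eq_range_aeval] at hT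
  obtain ⟨p, rfl⟩ := hT
  -- `l i⋆` acts on `q (l i) ξ` by removing the constant term of `q` and dividing by the variable.
  have hstar : ∀ (q : Polynomial ℂ) (ξ : H), star (l i) ξ = 0 →
      star (l i) (Polynomial.aeval (l i) q ξ) = Polynomial.aeval (l i) q.divX ξ := by
    intro q ξ hξ
    rw [ContinuousLinearMap.aeval_apply_eq_divX, map_add, map_smul, hξ, h.star_left_apply_left,
      if_pos rfl, smul_zero, add_zero]
  change ∃ q : Polynomial ℂ, ∀ ξ : H, star (l i) ξ = 0 →
    Polynomial.aeval (α • (l i + star (l i)) + β • (l i * star (l i))) p ξ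
      = Polynomial.aeval (l i) q ξ
  have step : ∀ S : H →L[ℂ] H,
      (∃ q : Polynomial ℂ, ∀ ξ : H, star (l i) ξ = 0 → S ξ = Polynomial.aeval (l i) q ξ) →
      ∃ q : Polynomial ℂ, ∀ ξ : H, star (l i) ξ = 0 →
        ((α • (l i + star (l i)) + β • (l i * star (l i))) * S) ξ
          = Polynomial.aeval (l i) q ξ := by
    rintro S ⟨q, hq⟩
    refine ⟨Polynomial.C α * (Polynomial.X * q + q.divX)
      + Polynomial.C β * (Polynomial.X * q.divX), fun ξ hξ => ?_⟩
    simp [hq ξ hξ, hstar q ξ hξ, Algebra.algebraMap_eq_smul_one]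
  induction p using Polynomial.induction_on' with
  | add p₁ p₂ h₁ h₂ =>
    obtain ⟨q₁, h₁⟩ := h₁
    obtain ⟨q₂, h₂⟩ := h₂
    exact ⟨q₁ + q₂, fun ξ hξ => by simpa using congrArg₂ (· + ·) (h₁ ξ hξ) (h₂ ξ hξ)⟩
  | monomial n c =>
    induction n with
    | zero => exact ⟨Polynomial.C c, fun ξ _ => by simp⟩
    | succ n ih =>
      obtain ⟨q, hq⟩ := step _ ih
      refine ⟨q, fun ξ hξ => ?_⟩
      rw [← hq ξ hξ, ← Polynomial.X_mul_monomial, map_mul, Polynomial.aeval_X]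

/-- A polynomial in `α (l i + l i⋆) + β l i l i⋆` with vanishing vacuum expectation maps the kernel
of `l i⋆` into the range of `l i`. -/
theorem exists_apply_eq_left (h : IsFockRepresentation l r Ω) (i : κ) (α β : ℂ)
    {T : H →L[ℂ] H}
    (hT : T ∈ Algebra.adjoin ℂ {α • (l i + star (l i)) + β • (l i * star (l i))})
    (hφ : vacuumState Ω T = 0) {ξ : H} (hξ : star (l i) ξ = 0) : ∃ η, T ξ = l i η := by
  obtain ⟨q, hq⟩ := h.exists_polynomial_apply i α β hT
  have key : ∀ ξ, star (l i) ξ = 0 →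
      T ξ = l i (Polynomial.aeval (l i) q.divX ξ) + q.coeff 0 • ξ := by
    intro ξ hξ
    rw [hq ξ hξ, ContinuousLinearMap.aeval_apply_eq_divX]
  have h0 : q.coeff 0 = 0 := by
    rw [vacuumState_apply, key Ω (h.star_left_vacuum i), inner_add_right, h.inner_vacuum_left,
      inner_smul_right, h.inner_vacuum_vacuum] at hφ
    simpa using hφ
  exact ⟨_, by rw [key ξ hξ, h0, zero_smul, add_zero]⟩

/-- The algebras generated by operators attached to different letters are free in the vacuum
state: an alternating product of centered elements maps the vacuum into the range of the creation
operator of its first letter. -/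
theorem areFree (h : IsFockRepresentation l r Ω) (α β : κ → ℂ) :
    AreFree (vacuumState Ω) fun i =>
      Algebra.adjoin ℂ {α i • (l i + star (l i)) + β i • (l i * star (l i))} := by
  have key : ∀ (L : List (κ × (H →L[ℂ] H))) (p : κ × (H →L[ℂ] H)),
      ((p :: L).map Prod.fst).IsChain (fun i j => i ≠ j) →
      (∀ q ∈ p :: L, q.2 ∈ Algebra.adjoin ℂ
          {α q.1 • (l q.1 + star (l q.1)) + β q.1 • (l q.1 * star (l q.1))} ∧
        vacuumState Ω q.2 = 0) →
      ∃ η, ((p :: L).map Prod.snd).prod Ω = l p.1 η := by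
    intro L
    induction L with
    | nil =>
      intro p _ hp
      obtain ⟨hp₁, hp₂⟩ := hp p (by simp)
      simpa using h.exists_apply_eq_left p.1 _ _ hp₁ hp₂ (h.star_left_vacuum p.1)
    | cons q L ih =>
      intro p hc hp
      obtain ⟨hp₁, hp₂⟩ := hp p (by simp)
      rw [List.map_cons, List.map_cons, List.isChain_cons_cons] at hc
      obtain ⟨η, hη⟩ := ih q hc.2 fun s hs => hp s (List.mem_cons_of_mem _ hs)
      rw [List.map_cons, List.prod_cons, mul_apply_eq_comp, hη]
      refine h.exists_apply_eq_left p.1 _ _ hp₁ hp₂ ?_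
      rw [h.star_left_apply_left, if_neg hc.1]
  intro L hL hc hp
  obtain ⟨p, L, rfl⟩ := List.exists_cons_of_ne_nil hL
  obtain ⟨η, hη⟩ := key L p hc hp
  rw [vacuumState_apply, hη, h.inner_vacuum_left]

end IsFockRepresentation

end VacuumState

/-! ### The resolvent of the sum -/

section Resolvent

variable {H : Type*} [NormedAddCommGroup H] [InnerProductSpace ℂ H] [CompleteSpace H]

/-- The operator `α (l₀ + l₀⋆) + β l₀ l₀⋆ + σ (l₁ + l₁⋆)`. For suitable coefficients and in the
vacuum state, it is the sum of a centered free Poisson element and a free semicircular one. -/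
noncomputable def fockSum (l : Fin 2 → H →L[ℂ] H) (α β σ : ℝ) : H →L[ℂ] H :=
  (α : ℂ) • (l 0 + star (l 0)) + (β : ℂ) • (l 0 * star (l 0)) + (σ : ℂ) • (l 1 + star (l 1))

theorem fockSum_apply (l : Fin 2 → H →L[ℂ] H) (α β σ : ℝ) (v : H) :
    fockSum l α β σ v = (α : ℂ) • (l 0 v + star (l 0) v) + (β : ℂ) • l 0 (star (l 0) v)
      + (σ : ℂ) • (l 1 v + star (l 1) v) := by
  simp [fockSum]

theorem isSelfAdjoint_fockSum (l : Fin 2 → H →L[ℂ] H) (α β σ : ℝ) :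
    IsSelfAdjoint (fockSum l α β σ) := by
  simp only [IsSelfAdjoint, fockSum, star_add, star_smul, star_mul, star_star, RCLike.star_def,
    Complex.conj_ofReal]
  abel_nf

/-- The imaginary part of a diagonal entry of the resolvent of a self-adjoint operator. -/
theorem IsSelfAdjoint.im_inner_of_sub_smul_eq {X : H →L[ℂ] H} (hX : IsSelfAdjoint X) {z : ℂ}
    {u v : H} (hu : X u - z • u = v) : (⟪v, u⟫_ℂ).im = z.im * ‖u‖ ^ 2 := by
  have h1 : (⟪X u, u⟫_ℂ).im = 0 := by
    rw [← Complex.conj_eq_iff_im, inner_conj_symm, ← ContinuousLinearMap.star_inner_right,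
      hX.star_eq]
  rw [← hu, inner_sub_left, inner_smul_left, inner_self_eq_norm_sq_to_K, Complex.sub_im, h1]
  simp [← Complex.ofReal_pow]

namespace IsFockRepresentation

variable {l r : Fin 2 → H →L[ℂ] H} {Ω : H}

/-- The vacuum entry of the resolvent of `fockSum l α β σ` is a root of a cubic polynomial. The
right creation operators commute with the operator up to terms containing the vacuum, which
gives linear relations between the vacuum entry `m` and the entries at the one-letter words. -/
theorem vacuum_resolvent_equation (h : IsFockRepresentation l r Ω) (α β σ : ℝ) {z : ℂ}
    {R : H →L[ℂ] H} (hR : ∀ v, R (fockSum l α β σ v - z • v) = v)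
    (hR' : ∀ v, fockSum l α β σ (R v) - z • R v = v) :
    (1 + β * ⟪Ω, R Ω⟫_ℂ) * (1 + z * ⟪Ω, R Ω⟫_ℂ + σ ^ 2 * ⟪Ω, R Ω⟫_ℂ ^ 2)
      + α ^ 2 * ⟪Ω, R Ω⟫_ℂ ^ 2 = 0 := by
  set m := ⟪Ω, R Ω⟫_ℂ with hm
  have hlr : ∀ i j v, l i (r j v) = r j (l i v) := fun i j v => by
    have := congrArg (fun T : H →L[ℂ] H => T v) (h.left_mul_right i j)
    simpa only [mul_apply_eq_comp] using this
  -- `X (r i v) - r i (X v)` only involves the component of `v` along the vacuum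
  have e0 : fockSum l α β σ (r 0 (R Ω)) - z • r 0 (R Ω) =
      (1 + β * m) • l 0 Ω + (α * m) • Ω := by
    have := congrArg (r 0) (hR' Ω)
    rw [h.right_vacuum, fockSum_apply] at this
    rw [fockSum_apply, hlr, hlr, h.star_left_right, h.star_left_right, if_pos rfl,
      if_neg (by decide), ← hm, map_add (l 0), hlr, map_smul (l 0), add_smul, one_smul, ← this]
    simp only [map_add, map_sub, map_smul]
    module
  have e1 : fockSum l α β σ (r 1 (R Ω)) - z • r 1 (R Ω) = l 1 Ω + (σ * m) • Ω := by
    have := congrArg (r 1) (hR' Ω)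
    rw [h.right_vacuum, fockSum_apply] at this
    rw [fockSum_apply, hlr, hlr, h.star_left_right, h.star_left_right, if_pos rfl,
      if_neg (by decide), ← hm, add_zero, hlr, ← this]
    simp only [map_add, map_sub, map_smul]
    module
  have e2 : fockSum l α β σ Ω - z • Ω = (α : ℂ) • l 0 Ω + (σ : ℂ) • l 1 Ω - z • Ω := by
    rw [fockSum_apply, h.star_left_vacuum, h.star_left_vacuum, map_zero]
    simp
  have f0 := congrArg (fun v => ⟪Ω, R v⟫_ℂ) e0
  have f1 := congrArg (fun v => ⟪Ω, R v⟫_ℂ) e1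
  have f2 := congrArg (fun v => ⟪Ω, R v⟫_ℂ) e2
  simp only [hR, h.inner_vacuum_right, map_add, map_sub, map_smul, inner_add_right,
    inner_sub_right, inner_smul_right, h.inner_vacuum_vacuum, ← hm] at f0 f1 f2
  linear_combination (1 + β * m) * f2 - α * f0 - σ * (1 + β * m) * f1

/-- The geometric series of `t₀ l₀ + t₁ l₁` converges for `|t₀|² + |t₁|² < 1`. -/
theorem isUnit_one_sub (h : IsFockRepresentation l r Ω) {t : Fin 2 → ℂ}
    (ht : ‖t 0‖ ^ 2 + ‖t 1‖ ^ 2 < 1) : IsUnit (1 - (t 0 • l 0 + t 1 • l 1)) := by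
  apply isUnit_one_sub_of_norm_lt_one
  refine lt_of_le_of_lt (b := √(‖t 0‖ ^ 2 + ‖t 1‖ ^ 2))
    (ContinuousLinearMap.opNorm_le_bound _ (Real.sqrt_nonneg _) fun v => ?_)
    (by rwa [Real.sqrt_lt' one_pos, one_pow])
  have hl : ∀ i j, ⟪l i v, l j v⟫_ℂ = if i = j then ((‖v‖ ^ 2 : ℝ) : ℂ) else 0 := fun i j => by
    rw [← ContinuousLinearMap.star_inner_right, h.star_left_apply_left]
    split_ifs
    · rw [inner_self_eq_norm_sq_to_K]; simp
    · simp
  refine le_of_sq_le_sq ?_ (by positivity)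
  rw [mul_pow, Real.sq_sqrt (by positivity)]
  apply le_of_eq
  have : ((‖(t 0 • l 0 + t 1 • l 1) v‖ ^ 2 : ℝ) : ℂ)
      = (((‖t 0‖ ^ 2 + ‖t 1‖ ^ 2) * ‖v‖ ^ 2 : ℝ) : ℂ) := by
    have h2 := inner_self_eq_norm_sq_to_K (𝕜 := ℂ) ((t 0 • l 0 + t 1 • l 1) v)
    simp only [Complex.coe_algebraMap] at h2
    rw [Complex.ofReal_pow, ← h2]
    simp only [add_apply, smul_apply, inner_add_left, inner_add_right,
      inner_smul_left, inner_smul_right, hl]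
    have e : ∀ w : ℂ, (starRingEnd ℂ) w * w = ((‖w‖ ^ 2 : ℝ) : ℂ) := fun w => by
      rw [Complex.ofReal_pow, Complex.conj_mul']
    simp only [if_true, Fin.isValue, zero_ne_one, one_ne_zero, if_false, mul_zero, add_zero,
      zero_add, ← mul_assoc]
    push_cast
    have e0 := e (t 0)
    have e1 := e (t 1)
    push_cast at e0 e1
    linear_combination (‖v‖ : ℂ) ^ 2 * e0 + (‖v‖ : ℂ) ^ 2 * e1
  exact_mod_cast this

/-- A solution `w` of the cubic equation in the upper half plane is the vacuum entry of the
resolvent: the vector `w (1 - t₀ l₀ - t₁ l₁)⁻¹ Ω`, with `t₀ = -α w / (1 + β w)` and `t₁ = -σ w`,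
solves `(X - z) u = Ω`. The imaginary part of the equation says that the geometric series
converges. -/
theorem eq_vacuum_resolvent (h : IsFockRepresentation l r Ω) (α β σ : ℝ) {z w : ℂ}
    (hz : 0 < z.im) (hw : 0 < w.im)
    (hcubic : (1 + β * w) * (1 + z * w + σ ^ 2 * w ^ 2) + α ^ 2 * w ^ 2 = 0)
    (hβ : 1 + β * w ≠ 0)
    {R : H →L[ℂ] H} (hR : ∀ v, R (fockSum l α β σ v - z • v) = v) :
    w = ⟪Ω, R Ω⟫_ℂ := by
  have hw0 : w ≠ 0 := fun h0 => by simp [h0] at hw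
  obtain ⟨d, hd⟩ : ∃ d : ℂ, d = 1 + β * w := ⟨_, rfl⟩
  rw [← hd] at hβ hcubic
  let t : Fin 2 → ℂ := ![-(α * w) / d, -(σ * w)]
  have ht : ‖t 0‖ ^ 2 + ‖t 1‖ ^ 2 < 1 := by
    have e : -w⁻¹ - z = α ^ 2 * (w / d) + σ ^ 2 * w := by
      field_simp
      linear_combination -hcubic
    have e' := congrArg Complex.im e
    have h1 : (w / d).im = w.im / ‖d‖ ^ 2 := by
      rw [Complex.div_im, Complex.sq_norm, ← sub_div]
      congr 1
      simp [hd]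
      ring
    rw [Complex.sub_im, Complex.neg_im, Complex.inv_im, Complex.add_im, ← Complex.ofReal_pow,
      ← Complex.ofReal_pow, Complex.im_ofReal_mul, Complex.im_ofReal_mul, h1,
      ← Complex.sq_norm] at e'
    have hwn : 0 < ‖w‖ := norm_pos_iff.2 hw0
    have hβn : 0 < ‖d‖ := norm_pos_iff.2 hβ
    have e0 : ‖t 0‖ ^ 2 = α ^ 2 * ‖w‖ ^ 2 / ‖d‖ ^ 2 := by
      simp [t, mul_pow, div_pow]
    have e1 : ‖t 1‖ ^ 2 = σ ^ 2 * ‖w‖ ^ 2 := by simp [t, mul_pow]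
    rw [e0, e1]
    have : w.im * (1 - (α ^ 2 * ‖w‖ ^ 2 / ‖d‖ ^ 2 + σ ^ 2 * ‖w‖ ^ 2))
        = z.im * ‖w‖ ^ 2 := by
      field_simp at e' ⊢
      linear_combination e'
    have h3 : 0 < w.im * (1 - (α ^ 2 * ‖w‖ ^ 2 / ‖d‖ ^ 2 + σ ^ 2 * ‖w‖ ^ 2)) := by
      rw [this]; positivity
    linarith [pos_of_mul_pos_right h3 hw.le]
  obtain ⟨S, hS⟩ := (h.isUnit_one_sub ht).exists_right_inv
  let u := w • S Ω
  have hu : u = w • Ω + t 0 • l 0 u + t 1 • l 1 u := by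
    have := congrArg (fun T : H →L[ℂ] H => w • T Ω) hS
    simp only [mul_apply_eq_comp, one_apply_eq_self, sub_apply, add_apply,
      smul_apply] at this
    simp only [u, map_smul]
    rw [← this]
    module
  clear_value u
  have hs : ∀ i, star (l i) u = t i • u := fun i => by
    conv_lhs => rw [hu]
    simp only [map_add, map_smul, h.star_left_vacuum, h.star_left_apply_left]
    fin_cases i <;> simp
  have hX : fockSum l α β σ u - z • u = Ω := by
    rw [fockSum_apply, hs, hs, map_smul]
    have c0 : (α + β * t 0 : ℂ) = -w⁻¹ * t 0 := by
      simp only [t, Matrix.cons_val_zero]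
      field_simp
      rw [hd]
      ring
    have c1 : (σ : ℂ) = -w⁻¹ * t 1 := by
      simp only [t, Matrix.cons_val_one, Matrix.cons_val_fin_one]
      field_simp
    have c2 : (α * t 0 + σ * t 1 - z : ℂ) = w⁻¹ := by
      simp only [t, Matrix.cons_val_one, Matrix.cons_val_fin_one, Matrix.cons_val_zero]
      field_simp
      linear_combination -hcubic
    clear_value t
    calc _ = (α + β * t 0 : ℂ) • l 0 u + (σ : ℂ) • l 1 u + (α * t 0 + σ * t 1 - z : ℂ) • u := by
          module
      _ = w⁻¹ • (u - (t 0 • l 0 u + t 1 • l 1 u)) := by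
          rw [c0, c2, show (σ : ℂ) • l 1 u = (-w⁻¹ * t 1) • l 1 u by rw [← c1]]
          module
      _ = w⁻¹ • (w • Ω) := by
          congr 1
          nth_rewrite 1 [hu]
          abel
      _ = Ω := inv_smul_smul₀ hw0 Ω
  have : R Ω = u := by rw [← hX, hR]
  rw [this, hu, inner_add_right, inner_add_right, inner_smul_right, inner_smul_right,
    inner_smul_right, h.inner_vacuum_left, h.inner_vacuum_left, h.inner_vacuum_vacuum]
  ring

end IsFockRepresentation

end Resolvent

/-! ### Joint moments of free elements -/

section JointMoments

open Polynomial

variable {A A' : Type*} [CStarAlgebra A] [CStarAlgebra A'] {ι : Type*}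

theorem areFreeElements_iff {φ : A →ₗ[ℂ] ℂ} {x y : A} :
    AreFreeElements φ x y ↔
      AreFree φ fun i : Fin 2 => Algebra.adjoin ℂ {(![x, y] : Fin 2 → A) i} := by
  have e : ![Algebra.adjoin ℂ {x}, Algebra.adjoin ℂ {y}]
      = fun i : Fin 2 => Algebra.adjoin ℂ {(![x, y] : Fin 2 → A) i} := by
    funext i; fin_cases i <;> rfl
  rw [AreFreeElements, e]

/-- If the elements `g i` are free, and so are the `g' i`, and the `g i` have the same moments as
the `g' i`, then the sums over two indices have the same moments. The reason is that in `A × A'`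
the alternating products of centered polynomials in the `(g i, g' i)` span, together with `1`, a
space that is stable under left multiplication by the `(g i, g' i)`. -/
theorem AreFree.moment_add_eq {φ : A →ₗ[ℂ] ℂ} {φ' : A' →ₗ[ℂ] ℂ} (hφ : φ 1 = 1) (hφ' : φ' 1 = 1)
    {g : ι → A} {g' : ι → A'} (hg : AreFree φ fun i => Algebra.adjoin ℂ {g i})
    (hg' : AreFree φ' fun i => Algebra.adjoin ℂ {g' i})
    (hm : ∀ i n, φ (g i ^ n) = φ' (g' i ^ n)) (i j : ι) (n : ℕ) :
    φ ((g i + g j) ^ n) = φ' ((g' i + g' j) ^ n) := by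
  classical
  have hpoly : ∀ i (q : ℂ[X]), φ (aeval (g i) q) = φ' (aeval (g' i) q) := fun i q => by
    induction q using Polynomial.induction_on' with
    | add p q hp hq => simp [hp, hq]
    | monomial n c => simp [aeval_monomial, ← Algebra.smul_def, hm]
  let G : ι → A × A' := fun i => (g i, g' i)
  have fst_aeval : ∀ i (q : ℂ[X]), (aeval (G i) q).1 = aeval (g i) q := fun i q =>
    (aeval_algHom_apply (AlgHom.fst ℂ A A') (G i) q).symm
  have snd_aeval : ∀ i (q : ℂ[X]), (aeval (G i) q).2 = aeval (g' i) q := fun i q =>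
    (aeval_algHom_apply (AlgHom.snd ℂ A A') (G i) q).symm
  let ev : List (ι × ℂ[X]) → A × A' := fun L => (L.map fun p => aeval (G p.1) p.2).prod
  let good : Set (List (ι × ℂ[X])) :=
    {L | (L.map Prod.fst).IsChain (fun i j => i ≠ j) ∧ ∀ p ∈ L, φ (aeval (g p.1) p.2) = 0}
  let W : Submodule ℂ (A × A') := Submodule.span ℂ (ev '' good)
  have hev : ∀ L ∈ good, ev L ∈ W := fun L hL => Submodule.subset_span ⟨L, hL, rfl⟩
  have hone : (1 : A × A') ∈ W := hev [] ⟨by simp, by simp⟩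
  have center : ∀ i (q : ℂ[X]), φ (aeval (g i) (q - C (φ (aeval (g i) q)))) = 0 := fun i q => by
    simp [Algebra.algebraMap_eq_smul_one, hφ]
  have hmul : ∀ i, ∀ b ∈ W, G i * b ∈ W := by
    intro i b hb
    induction hb using Submodule.span_induction with
    | zero => simp
    | add b c _ _ hb hc => rw [mul_add]; exact W.add_mem hb hc
    | smul c b _ hb => rw [mul_smul_comm]; exact W.smul_mem c hb
    | mem b hb =>
      obtain ⟨L, ⟨hc, h0⟩, rfl⟩ := hb
      -- A letter different from the first one of `L` starts a longer alternating product.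
      have new : ((i :: L.map Prod.fst).IsChain fun i j => i ≠ j) → G i * ev L ∈ W := by
        intro hc'
        have e : G i * ev L = ev ((i, X - C (φ (aeval (g i) (X : ℂ[X])))) :: L)
            + φ (aeval (g i) (X : ℂ[X])) • ev L := by
          simp [ev, Algebra.algebraMap_eq_smul_one, sub_mul]
        rw [e]
        refine W.add_mem (hev _ ⟨by simpa using hc', ?_⟩) (W.smul_mem _ (hev _ ⟨hc, h0⟩))
        intro p hp
        rcases List.mem_cons.1 hp with rfl | hp
        · exact center i X
        · exact h0 p hp
      rcases L with _ | ⟨⟨k, q⟩, L⟩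
      · exact new (by simp)
      by_cases hik : i = k
      · subst hik
        have e : G i * ev ((i, q) :: L) = ev ((i, X * q - C (φ (aeval (g i) (X * q)))) :: L)
            + φ (aeval (g i) (X * q)) • ev L := by
          simp [ev, Algebra.algebraMap_eq_smul_one, sub_mul, mul_assoc]
        have hL : L ∈ good := ⟨hc.tail, fun p hp => h0 p (List.mem_cons_of_mem _ hp)⟩
        rw [e]
        refine W.add_mem (hev _ ⟨by simpa using hc, ?_⟩) (W.smul_mem _ (hev _ hL))
        intro p hp
        rcases List.mem_cons.1 hp with rfl | hp
        · exact center i (X * q)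
        · exact hL.2 p hp
      · exact new (by simpa using ⟨hik, by simpa using hc⟩)
  have hW : ∀ b ∈ W, φ b.1 = φ' b.2 := by
    intro b hb
    induction hb using Submodule.span_induction with
    | zero => simp
    | add b c _ _ hb hc => simp [hb, hc]
    | smul c b _ hb => simp [hb]
    | mem b hb =>
      obtain ⟨L, ⟨hc, h0⟩, rfl⟩ := hb
      have h1 : (ev L).1 = ((L.map fun p => (p.1, aeval (g p.1) p.2)).map Prod.snd).prod := by
        change RingHom.fst A A' (ev L) = _
        rw [map_list_prod, List.map_map, List.map_map]
        congr 2
        exact funext fun p => fst_aeval p.1 p.2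
      have h2 : (ev L).2 = ((L.map fun p => (p.1, aeval (g' p.1) p.2)).map Prod.snd).prod := by
        change RingHom.snd A A' (ev L) = _
        rw [map_list_prod, List.map_map, List.map_map]
        congr 2
        exact funext fun p => snd_aeval p.1 p.2
      rcases eq_or_ne L [] with rfl | hL
      · simp [ev, hφ, hφ']
      rw [h1, h2, hg _ (by simpa using hL) (by simpa [Function.comp_def] using hc),
        hg' _ (by simpa using hL) (by simpa [Function.comp_def] using hc)]
      · intro p hp
        obtain ⟨p, hpL, rfl⟩ := List.mem_map.1 hp
        exact ⟨aeval_mem_adjoin_singleton ℂ _, (hpoly _ _).symm.trans (h0 p hpL)⟩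
      · intro p hp
        obtain ⟨p, hpL, rfl⟩ := List.mem_map.1 hp
        exact ⟨aeval_mem_adjoin_singleton ℂ _, h0 p hpL⟩
  have hpow : (G i + G j) ^ n ∈ W := by
    induction n with
    | zero => simpa using hone
    | succ n ih =>
      rw [pow_succ', add_mul]
      exact W.add_mem (hmul i _ ih) (hmul j _ ih)
  exact hW _ hpow

/-- The moments of the sum of two free elements depend only on the moments of the summands. -/
theorem AreFreeElements.moment_add_eq {φ : A →ₗ[ℂ] ℂ} {φ' : A' →ₗ[ℂ] ℂ} (hφ : φ 1 = 1)
    (hφ' : φ' 1 = 1) {x y : A} {x' y' : A'} (h : AreFreeElements φ x y)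
    (h' : AreFreeElements φ' x' y') (hx : ∀ n, φ (x ^ n) = φ' (x' ^ n))
    (hy : ∀ n, φ (y ^ n) = φ' (y' ^ n)) (n : ℕ) :
    φ ((x + y) ^ n) = φ' ((x' + y') ^ n) := by
  refine AreFree.moment_add_eq hφ hφ' (areFreeElements_iff.1 h) (areFreeElements_iff.1 h') (fun i n => ?_) 0 1 n
  fin_cases i
  · exact hx n
  · exact hy n

end JointMoments

/-! ### The law of a self-adjoint element -/

section SpectralLaw

open MeasureTheory

variable {A : Type*} [CStarAlgebra A]

theorem IsState.im_cfcHom_eq_zero {φ : A →ₗ[ℂ] ℂ} (hφ : IsState φ) {a : A}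
    (ha : IsSelfAdjoint a) (f : C(spectrum ℝ a, ℝ)) : (φ (cfcHom ha f)).im = 0 := by
  have sq : ∀ g : C(spectrum ℝ a, ℝ), (φ (cfcHom ha (g * g))).im = 0 := fun g => by
    have := hφ.im_eq_zero (cfcHom ha g)
    rwa [← map_star, star_trivial, ← map_mul] at this
  -- every real function is a linear combination of two squares
  have e : (4 : ℂ) • cfcHom ha f
      = cfcHom ha ((f + 1) * (f + 1)) - cfcHom ha ((f - 1) * (f - 1)) := by
    rw [← map_sub, show (f + 1) * (f + 1) - (f - 1) * (f - 1) = f + f + f + f by ring]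
    simp only [map_add]
    module
  have e' := congrArg (fun x => (φ x).im) e
  simp only [map_smul, map_sub, Complex.sub_im, sq, smul_eq_mul, Complex.mul_im] at e'
  simpa using e'

theorem IsState.re_cfcHom_nonneg {φ : A →ₗ[ℂ] ℂ} (hφ : IsState φ) {a : A}
    (ha : IsSelfAdjoint a) {f : C(spectrum ℝ a, ℝ)} (hf : ∀ t, 0 ≤ f t) :
    0 ≤ (φ (cfcHom ha f)).re := by
  let g : C(spectrum ℝ a, ℝ) := ⟨fun t => √(f t), by fun_prop⟩
  have hg : g * g = f := by
    ext t
    exact Real.mul_self_sqrt (hf t)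
  have := hφ.nonneg_re (cfcHom ha g)
  rwa [← map_star, star_trivial, ← map_mul, hg] at this

/-- A self-adjoint element of a C⋆-probability space has a law, which computes the expectation of
every continuous function of the element. The measure comes from the Riesz–Markov–Kakutani theorem
on the spectrum. -/
theorem IsState.exists_hasSpectralLaw {φ : A →ₗ[ℂ] ℂ} (hφ : IsState φ) {a : A}
    (ha : IsSelfAdjoint a) : ∃ μ : Measure ℝ, HasSpectralLaw φ a μ ∧
      ∀ f : ℝ → ℝ, Continuous f → φ (cfc f a) = ((∫ t, f t ∂μ : ℝ) : ℂ) := by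
  let K := spectrum ℝ a
  let Λ : CompactlySupportedContinuousMap K ℝ →ₚ[ℝ] ℝ := PositiveLinearMap.mk₀
    { toFun := fun f => (φ (cfcHom ha f.toContinuousMap)).re
      map_add' := fun f g => by
        rw [show (f + g).toContinuousMap = f.toContinuousMap + g.toContinuousMap from rfl]
        simp
      map_smul' := fun c f => by
        rw [show (c • f).toContinuousMap = c • f.toContinuousMap from rfl, map_smul,
          ← Complex.coe_smul c, map_smul]
        simp }
    fun f hf => hφ.re_cfcHom_nonneg ha fun t => hf t
  let ν := RealRMK.rieszMeasure Λ
  let μ : Measure ℝ := ν.map Subtype.val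
  have hν : ∀ f : C(K, ℝ), φ (cfcHom ha f) = ((∫ t, f t ∂ν : ℝ) : ℂ) := fun f => by
    have h := RealRMK.integral_rieszMeasure Λ
      ⟨f, HasCompactSupport.of_compactSpace _⟩
    have h' : ∫ t, f t ∂ν = (φ (cfcHom ha f)).re := h
    rw [h']
    exact Complex.ext rfl (hφ.im_cfcHom_eq_zero ha f)
  have hμ : ∀ f : ℝ → ℝ, Continuous f → φ (cfc f a) = ((∫ t, f t ∂μ : ℝ) : ℂ) := by
    intro f hf
    rw [cfc_apply f a ha hf.continuousOn, hν]
    congr 1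
    rw [integral_map (by fun_prop) hf.aestronglyMeasurable]
    rfl
  have : IsFiniteMeasure μ := by
    have : IsFiniteMeasure ν := inferInstance
    infer_instance
  refine ⟨μ, ⟨ha, ⟨?_⟩, ?_, fun n => ?_⟩, hμ⟩
  · have h1 := hμ (fun _ => 1) continuous_const
    rw [cfc_const_one ℝ a, hφ.map_one] at h1
    have h2 : (1 : ℝ) = μ.real Set.univ := by
      rw [integral_const, smul_eq_mul, mul_one] at h1
      exact_mod_cast h1
    rw [← ENNReal.toReal_eq_one_iff, ← Measure.real, ← h2]
  · have hK : IsCompact K := ContinuousFunctionalCalculus.isCompact_spectrum a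
    refine hK.of_isClosed_subset Measure.isClosed_support
      (Measure.support_subset_of_isClosed hK.isClosed ?_)
    rw [mem_ae_iff, Measure.map_apply (by fun_prop) hK.measurableSet.compl]
    simp [K]
  · rw [← hμ (fun t => t ^ n) (by fun_prop), cfc_pow_id a n]

/-- The functional calculus form of `(t - z)⁻¹ = f t + i g t`. -/
theorem IsSelfAdjoint.sub_smul_mul_cfc_eq_one {a : A} (ha : IsSelfAdjoint a) {z : ℂ}
    {f g : ℝ → ℝ} (hf : Continuous f) (hg : Continuous g)
    (h1 : ∀ t, (t - z.re) * f t + z.im * g t = 1) (h2 : ∀ t, (t - z.re) * g t = z.im * f t) :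
    (a - z • 1) * (cfc f a + Complex.I • cfc g a) = 1 := by
  let x : ℝ → ℝ := fun t => t - z.re
  have hx : Continuous x := by fun_prop
  have e0 : a - z • (1 : A) = cfc x a - (Complex.I * z.im) • 1 := by
    rw [show cfc x a = a - algebraMap ℝ A z.re by
      rw [cfc_sub (fun t : ℝ => t) (fun _ => z.re) a, cfc_id' ℝ a, cfc_const z.re a],
      Algebra.algebraMap_eq_smul_one, ← Complex.coe_smul]
    conv_lhs => rw [← Complex.re_add_im z]
    module
  have e1 : cfc x a * cfc f a + (z.im : ℂ) • cfc g a = 1 := by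
    rw [Complex.coe_smul, ← cfc_mul x f a hx.continuousOn hf.continuousOn,
      ← cfc_smul z.im g a hg.continuousOn,
      ← cfc_add a (fun t => x t * f t) (fun t => z.im • g t) (hx.mul hf).continuousOn
        (hg.const_smul z.im).continuousOn,
      ← cfc_const_one ℝ a]
    exact congrArg (fun k => cfc k a) (funext h1)
  have e2 : cfc x a * cfc g a = (z.im : ℂ) • cfc f a := by
    rw [Complex.coe_smul, ← cfc_mul x g a hx.continuousOn hg.continuousOn,
      ← cfc_smul z.im f a hf.continuousOn]
    exact congrArg (fun k => cfc k a) (funext h2)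
  rw [e0]
  generalize cfc x a = X at *
  generalize cfc f a = F at *
  generalize cfc g a = G at *
  have hI : Complex.I * z.im * Complex.I = -z.im := by
    linear_combination z.im * Complex.I_mul_I
  calc _ = (X * F + (z.im : ℂ) • G) + Complex.I • (X * G - (z.im : ℂ) • F) := by
        rw [mul_add, sub_mul, sub_mul, mul_smul_comm, smul_mul_assoc, smul_mul_assoc, one_mul,
          one_mul, smul_smul _ Complex.I, hI]
        module
    _ = 1 := by rw [e1, e2, sub_self, smul_zero, add_zero]

/-- The Stieltjes transform of the law of a self-adjoint element is the expectation of its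
resolvent. -/
theorem stieltjesTransform_eq_of_resolvent {φ : A →ₗ[ℂ] ℂ} {a : A} (ha : IsSelfAdjoint a)
    {μ : Measure ℝ} [IsFiniteMeasure μ]
    (hμ : ∀ f : ℝ → ℝ, Continuous f → φ (cfc f a) = ((∫ t, f t ∂μ : ℝ) : ℂ))
    {z : ℂ} (hz : z.im ≠ 0) {R : A} (hR : R * (a - z • 1) = 1) :
    stieltjesTransform μ z = φ R := by
  have hpos : ∀ t : ℝ, 0 < (t - z.re) ^ 2 + z.im ^ 2 := fun t => by positivity
  obtain ⟨f, hfdef⟩ : ∃ f : ℝ → ℝ, f = fun t => (t - z.re) / ((t - z.re) ^ 2 + z.im ^ 2) :=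
    ⟨_, rfl⟩
  obtain ⟨g, hgdef⟩ : ∃ g : ℝ → ℝ, g = fun t => z.im / ((t - z.re) ^ 2 + z.im ^ 2) := ⟨_, rfl⟩
  have hf : Continuous f := by
    rw [hfdef]; exact Continuous.div (by fun_prop) (by fun_prop) fun t => (hpos t).ne'
  have hg : Continuous g := by
    rw [hgdef]; exact Continuous.div (by fun_prop) (by fun_prop) fun t => (hpos t).ne'
  have h1 : ∀ t, (t - z.re) * f t + z.im * g t = 1 := fun t => by
    have := (hpos t).ne'
    simp only [hfdef, hgdef]
    field_simp
  have h2 : ∀ t, (t - z.re) * g t = z.im * f t := fun t => by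
    simp only [hfdef, hgdef]
    ring
  have hRS : R = cfc f a + Complex.I • cfc g a := by
    rw [← mul_one R, ← ha.sub_smul_mul_cfc_eq_one hf hg h1 h2, ← mul_assoc, hR, one_mul]
  have hfi : Integrable f μ := by
    refine Integrable.of_bound hf.aestronglyMeasurable |z.im|⁻¹ (.of_forall fun t => ?_)
    rw [hfdef, Real.norm_eq_abs, abs_div, abs_of_pos (hpos t), div_le_iff₀ (hpos t), ← one_div,
      div_mul_eq_mul_div, one_mul, le_div_iff₀ (abs_pos.2 hz)]
    nlinarith [sq_abs (t - z.re), sq_abs z.im, sq_nonneg (|t - z.re| - |z.im|),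
      abs_nonneg (t - z.re), abs_nonneg z.im]
  have hgi : Integrable g μ := by
    refine Integrable.of_bound hg.aestronglyMeasurable |z.im|⁻¹ (.of_forall fun t => ?_)
    rw [hgdef, Real.norm_eq_abs, abs_div, abs_of_pos (hpos t), div_le_iff₀ (hpos t), ← one_div,
      div_mul_eq_mul_div, one_mul, le_div_iff₀ (abs_pos.2 hz)]
    nlinarith [sq_abs z.im, sq_nonneg (t - z.re)]
  rw [hRS, stieltjesTransform_eq, map_add, map_smul, hμ f hf, hμ g hg, smul_eq_mul,
    ← integral_complex_ofReal, ← integral_complex_ofReal, ← integral_const_mul,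
    ← integral_add hfi.ofReal (hgi.ofReal.const_mul _)]
  refine integral_congr_ae (.of_forall fun t => inv_eq_of_mul_eq_one_right ?_)
  have h1' : ((t : ℂ) - z.re) * f t + z.im * g t = 1 := by exact_mod_cast h1 t
  have h2' : ((t : ℂ) - z.re) * g t = z.im * f t := by exact_mod_cast h2 t
  change ((t : ℂ) - z) * ((f t : ℂ) + Complex.I * g t) = 1
  conv_lhs => rw [← Complex.re_add_im z]
  linear_combination h1' + Complex.I * h2' - z.im * g t * Complex.I_mul_I

end SpectralLaw

/-! ### Measures determined by their moments or by their Stieltjes transforms -/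

section Determinacy

open MeasureTheory
open scoped BoundedContinuousFunction

theorem MeasureTheory.Measure.integrable_of_isCompact_support {μ : Measure ℝ} [IsFiniteMeasure μ]
    (hμ : IsCompact μ.support) {f : ℝ → ℝ} (hf : Continuous f) : Integrable f μ := by
  obtain ⟨C, hC⟩ := hμ.exists_bound_of_continuousOn hf.continuousOn
  refine Integrable.of_bound hf.aestronglyMeasurable C ?_
  filter_upwards [Measure.support_mem_ae] with t ht using hC t ht

/-- Compactly supported probability measures on `ℝ` with the same moments coincide, by the
Weierstrass approximation theorem. -/
theorem MeasureTheory.Measure.ext_of_moments {μ ν : Measure ℝ} [IsProbabilityMeasure μ]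
    [IsProbabilityMeasure ν] (hμ : IsCompact μ.support) (hν : IsCompact ν.support)
    (h : ∀ n : ℕ, ∫ t, t ^ n ∂μ = ∫ t, t ^ n ∂ν) : μ = ν := by
  have hpoly : ∀ p : Polynomial ℝ, ∫ t, p.eval t ∂μ = ∫ t, p.eval t ∂ν := fun p => by
    simp only [Polynomial.eval_eq_sum_range]
    rw [integral_finsetSum _ fun i _ => Measure.integrable_of_isCompact_support hμ (by fun_prop),
      integral_finsetSum _ fun i _ => Measure.integrable_of_isCompact_support hν (by fun_prop)]
    simp only [integral_const_mul, h]
  refine ext_of_forall_integral_eq_of_IsFiniteMeasure fun f => ?_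
  obtain ⟨r, hr⟩ := (hμ.union hν).isBounded.subset_closedBall 0
  rw [Real.closedBall_eq_Icc] at hr
  refine eq_of_forall_dist_le fun ε hε => ?_
  obtain ⟨p, hp⟩ := exists_polynomial_near_of_continuousOn _ _ f f.continuous.continuousOn
    (ε / 2) (half_pos hε)
  have key : ∀ (ρ : Measure ℝ) [IsProbabilityMeasure ρ], IsCompact ρ.support →
      ρ.support ⊆ μ.support ∪ ν.support →
      dist (∫ t, p.eval t ∂ρ) (∫ t, f t ∂ρ) ≤ ε / 2 := fun ρ _ hρ hsub => by
    rw [dist_eq_norm, ← integral_sub (Measure.integrable_of_isCompact_support hρ p.continuous)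
      (f.integrable ρ)]
    have hae : ∀ᵐ t ∂ρ, ‖p.eval t - f t‖ ≤ ε / 2 := by
      filter_upwards [Measure.support_mem_ae] with t ht using (hp t (hr (hsub ht))).le
    simpa using norm_integral_le_of_norm_le_const hae
  calc dist (∫ t, f t ∂μ) (∫ t, f t ∂ν)
      ≤ dist (∫ t, p.eval t ∂μ) (∫ t, f t ∂μ) + dist (∫ t, p.eval t ∂μ) (∫ t, f t ∂ν) :=
        dist_triangle_left _ _ _
    _ ≤ ε / 2 + ε / 2 := by
        refine add_le_add (key μ hμ Set.subset_union_left) ?_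
        rw [hpoly]
        exact key ν hν Set.subset_union_right
    _ = ε := add_halves ε

/-- The bounded continuous function `t ↦ (t - z)⁻¹` on `ℝ`, for `z` not real. -/
noncomputable def resolventFunction (z : {z : ℂ // z.im ≠ 0}) : ℝ →ᵇ ℂ :=
  BoundedContinuousFunction.ofNormedAddCommGroup (fun t : ℝ => ((t : ℂ) - z)⁻¹)
    (Continuous.inv₀ (by fun_prop) fun t h => z.2 (by simpa using congrArg Complex.im h))
    |z.1.im|⁻¹ fun t => by
      rw [norm_inv]
      refine inv_anti₀ (abs_pos.2 z.2) ?_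
      simpa using Complex.abs_im_le_norm ((t : ℂ) - z)

theorem resolventFunction_apply (z : {z : ℂ // z.im ≠ 0}) (t : ℝ) :
    resolventFunction z t = ((t : ℂ) - z)⁻¹ := rfl

theorem norm_resolventFunction_le (z : {z : ℂ // z.im ≠ 0}) :
    ‖resolventFunction z‖ ≤ |z.1.im|⁻¹ :=
  BoundedContinuousFunction.norm_ofNormedAddCommGroup_le _ (by positivity) _

theorem ofReal_sub_ne_zero (z : {z : ℂ // z.im ≠ 0}) (t : ℝ) : (t : ℂ) - z ≠ 0 :=
  fun h => z.2 (by simpa using congrArg Complex.im h)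

/-- The resolvent identity. -/
theorem resolventFunction_sub (z w : {z : ℂ // z.im ≠ 0}) :
    resolventFunction w - resolventFunction z
      = (w.1 - z.1) • (resolventFunction z * resolventFunction w) := by
  ext t
  have h1 := ofReal_sub_ne_zero z t
  have h2 := ofReal_sub_ne_zero w t
  simp only [BoundedContinuousFunction.sub_apply, BoundedContinuousFunction.smul_apply,
    BoundedContinuousFunction.mul_apply, resolventFunction_apply, smul_eq_mul]
  field_simp
  ring

theorem star_resolventFunction (z : {z : ℂ // z.im ≠ 0}) :
    star (resolventFunction z) = resolventFunction ⟨star z.1, by simpa using z.2⟩ := by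
  ext t
  simp [resolventFunction_apply]

/-- The closed span of `1` and the functions `t ↦ (t - z)⁻¹`. -/
noncomputable def resolventSpan : Submodule ℂ (ℝ →ᵇ ℂ) :=
  (Submodule.span ℂ (insert 1 (Set.range resolventFunction))).topologicalClosure

theorem mem_resolventSpan_of_mem {f : ℝ →ᵇ ℂ} (hf : f ∈ insert 1 (Set.range resolventFunction)) :
    f ∈ resolventSpan :=
  Submodule.le_topologicalClosure _ (Submodule.subset_span hf)

theorem apply_mem_resolventSpan (T : (ℝ →ᵇ ℂ) →L[ℂ] (ℝ →ᵇ ℂ))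
    (hT : ∀ f ∈ insert 1 (Set.range resolventFunction), T f ∈ resolventSpan) {f : ℝ →ᵇ ℂ}
    (hf : f ∈ resolventSpan) : T f ∈ resolventSpan := by
  have hclosed : IsClosed (resolventSpan.comap T.toLinearMap : Set (ℝ →ᵇ ℂ)) :=
    (Submodule.isClosed_topologicalClosure _).preimage T.continuous
  have hle : Submodule.span ℂ (insert 1 (Set.range resolventFunction))
      ≤ resolventSpan.comap T.toLinearMap := Submodule.span_le.2 fun f hf => hT f hf
  exact Submodule.topologicalClosure_minimal _ hle hclosed hf

/-- The product of two resolvents is a combination of them if they are distinct; the square of a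
resolvent is a limit of such products. -/
theorem resolventFunction_mul_mem (z w : {z : ℂ // z.im ≠ 0}) :
    resolventFunction z * resolventFunction w ∈ resolventSpan := by
  have hres : ∀ w, resolventFunction w ∈ resolventSpan := fun w =>
    mem_resolventSpan_of_mem (Or.inr ⟨w, rfl⟩)
  have hne : ∀ z w : {z : ℂ // z.im ≠ 0}, w.1 ≠ z.1 →
      resolventFunction z * resolventFunction w ∈ resolventSpan := fun z w hzw => by
    have h := resolventFunction_sub z w
    rw [← inv_smul_eq_iff₀ (sub_ne_zero.2 hzw)] at h
    rw [← h]
    exact Submodule.smul_mem _ _ (Submodule.sub_mem _ (hres w) (hres z))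
  by_cases hzw : w.1 = z.1
  · obtain rfl : w = z := Subtype.ext hzw
    have hs : ∀ n : ℕ, (0 : ℝ) < 1 / ((n : ℝ) + 1) := fun n => Nat.one_div_pos_of_nat
    have him : ∀ n : ℕ, (w.1 + Complex.I * (w.1.im * (1 / ((n : ℝ) + 1) : ℝ) : ℝ)).im
        = w.1.im * (1 + 1 / ((n : ℝ) + 1)) := fun n => by
      rw [Complex.add_im, Complex.I_mul_im, Complex.ofReal_re]; ring
    let v : ℕ → {z : ℂ // z.im ≠ 0} := fun n =>
      ⟨w.1 + Complex.I * (w.1.im * (1 / ((n : ℝ) + 1) : ℝ) : ℝ), by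
        rw [him]; exact mul_ne_zero w.2 (by linarith [hs n] : (0 : ℝ) < _).ne'⟩
    have hv : ∀ n, (v n).1 - w.1 = Complex.I * (w.1.im * (1 / ((n : ℝ) + 1) : ℝ) : ℝ) :=
      fun n => by simp only [v]; ring
    refine isClosed_closure.mem_of_tendsto (b := Filter.atTop)
      (f := fun n => resolventFunction w * resolventFunction (v n)) ?_
      (.of_forall fun n => hne w (v n) ?_)
    · refine Filter.Tendsto.const_mul _ ?_
      rw [tendsto_iff_norm_sub_tendsto_zero]
      refine squeeze_zero (g := fun n : ℕ => |w.1.im| * (1 / ((n : ℝ) + 1))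
        * (|w.1.im|⁻¹ * |w.1.im|⁻¹)) (fun _ => norm_nonneg _) (fun n => ?_) ?_
      · rw [resolventFunction_sub, norm_smul, hv]
        refine mul_le_mul (le_of_eq ?_) ((norm_mul_le _ _).trans
          (mul_le_mul (norm_resolventFunction_le _) ((norm_resolventFunction_le _).trans ?_)
            (norm_nonneg _) (by positivity))) (norm_nonneg _) (by positivity)
        · rw [norm_mul, Complex.norm_I, one_mul, Complex.norm_real, Real.norm_eq_abs, abs_mul,
            abs_of_pos (hs n)]
        · refine inv_anti₀ (abs_pos.2 w.2) ?_
          rw [him, abs_mul]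
          exact le_mul_of_one_le_right (abs_nonneg _)
            ((by linarith [hs n] : (1 : ℝ) ≤ _).trans (le_abs_self _))
      · have := (tendsto_one_div_add_atTop_nhds_zero_nat (𝕜 := ℝ)).const_mul |w.1.im|
        simpa using this.mul_const (|w.1.im|⁻¹ * |w.1.im|⁻¹)
    · rw [← sub_ne_zero, hv]
      refine mul_ne_zero Complex.I_ne_zero (Complex.ofReal_ne_zero.2 (mul_ne_zero w.2 (hs n).ne'))
  · exact hne z w hzw

/-- The closed span of `1` and the resolvents, as a star subalgebra. -/
noncomputable def resolventSubalgebra : StarSubalgebra ℂ (ℝ →ᵇ ℂ) where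
  carrier := resolventSpan
  add_mem' := resolventSpan.add_mem
  algebraMap_mem' c := by
    rw [Algebra.algebraMap_eq_smul_one]
    exact resolventSpan.smul_mem c (mem_resolventSpan_of_mem (Or.inl rfl))
  mul_mem' := by
    have key : ∀ f ∈ insert 1 (Set.range resolventFunction), ∀ g ∈ resolventSpan,
        f * g ∈ resolventSpan := by
      intro f hf g hg
      refine apply_mem_resolventSpan (ContinuousLinearMap.mul ℂ (ℝ →ᵇ ℂ) f) (fun g hg => ?_) hg
      rw [ContinuousLinearMap.mul_apply']
      rcases hf with rfl | ⟨z, rfl⟩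
      · rw [one_mul]
        exact mem_resolventSpan_of_mem hg
      · rcases hg with rfl | ⟨w, rfl⟩
        · rw [mul_one]
          exact mem_resolventSpan_of_mem (Or.inr ⟨z, rfl⟩)
        · exact resolventFunction_mul_mem z w
    intro f g hf hg
    exact apply_mem_resolventSpan ((ContinuousLinearMap.mul ℂ (ℝ →ᵇ ℂ)).flip g)
      (fun f hf => key f hf g hg) hf
  star_mem' := by
    intro f hf
    refine map_mem_closure (f := star) continuous_star hf fun f hf => ?_
    induction hf using Submodule.span_induction with
    | zero => simp
    | add a b _ _ ha hb => rw [star_add]; exact Submodule.add_mem _ ha hb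
    | smul c a _ ha => rw [star_smul]; exact Submodule.smul_mem _ _ ha
    | mem f hf =>
      refine Submodule.subset_span ?_
      rcases hf with rfl | ⟨z, rfl⟩
      · simp
      · exact Or.inr ⟨_, (star_resolventFunction z).symm⟩

/-- A probability measure on `ℝ` is determined by its Stieltjes transform on the upper half
plane, by the Stone–Weierstrass theorem for the algebra generated by the resolvents. -/
theorem ext_of_stieltjesTransform {μ ν : Measure ℝ} [IsProbabilityMeasure μ]
    [IsProbabilityMeasure ν]
    (h : ∀ z : ℂ, 0 < z.im → stieltjesTransform μ z = stieltjesTransform ν z) : μ = ν := by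
  refine ext_of_forall_mem_subalgebra_integral_eq_of_pseudoEMetric_complete_countable
    (A := resolventSubalgebra) ?_ ?_
  · intro s t hst
    refine ⟨_, ⟨_, ⟨resolventFunction ⟨Complex.I, by simp⟩,
      mem_resolventSpan_of_mem (Or.inr ⟨_, rfl⟩), rfl⟩, rfl⟩, fun e => hst ?_⟩
    have e' : ((s : ℂ) - Complex.I)⁻¹ = ((t : ℂ) - Complex.I)⁻¹ := e
    simpa using e'
  have hI : ∀ (ρ : Measure ℝ) [IsProbabilityMeasure ρ],
      Continuous fun g : ℝ →ᵇ ℂ => ∫ t, g t ∂ρ := fun ρ _ => by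
    refine LipschitzWith.continuous (K := 1) (LipschitzWith.of_dist_le_mul fun f g => ?_)
    rw [dist_eq_norm, dist_eq_norm, ← integral_sub (f.integrable ρ) (g.integrable ρ)]
    simpa using norm_integral_le_of_norm_le_const (μ := ρ)
      (.of_forall fun t => (f - g).norm_coe_le_norm t)
  intro g hg
  refine closure_minimal (fun g hg => ?_) (isClosed_eq (hI μ) (hI ν)) hg
  induction hg using Submodule.span_induction with
  | zero => simp
  | add a b _ _ ha hb =>
    simp only [Set.mem_ofPred_eq, BoundedContinuousFunction.add_apply] at ha hb ⊢
    rw [integral_add (a.integrable μ) (b.integrable μ), integral_add (a.integrable ν)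
      (b.integrable ν), ha, hb]
  | smul c a _ ha =>
    simp only [Set.mem_ofPred_eq, BoundedContinuousFunction.smul_apply] at ha ⊢
    rw [integral_smul, integral_smul, ha]
  | mem g hg =>
    have hup : ∀ z : {z : ℂ // z.im ≠ 0}, 0 < z.1.im →
        ∫ t, resolventFunction z t ∂μ = ∫ t, resolventFunction z t ∂ν := fun z hz => by
      have := h z.1 hz
      rwa [stieltjesTransform_eq, stieltjesTransform_eq] at this
    rcases hg with rfl | ⟨z, rfl⟩
    · simp
    · rcases lt_or_gt_of_ne z.2 with hz | hz
      · have e := hup ⟨star z.1, by simpa using z.2⟩ (by simpa using hz)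
        rw [← star_resolventFunction] at e
        simp only [BoundedContinuousFunction.star_apply, RCLike.star_def, integral_conj] at e
        exact (starRingEnd ℂ).injective e
      · exact hup z hz

end Determinacy

/-! ### The semicircle and Marchenko–Pastur laws in terms of the angle -/

section Laws

open MeasureTheory

/-- The substitution `x = c + 2 s cos θ` in a measure on `[c - 2 s, c + 2 s]` with a density. -/
theorem withDensity_Icc_eq_map_cos (c : ℝ) {s : ℝ} (hs : 0 < s) (d : ℝ → ℝ) :
    (volume.restrict (Set.Icc (c - 2 * s) (c + 2 * s))).withDensity
        (fun x => ENNReal.ofReal (d x))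
      = ((volume.restrict (Set.Icc 0 Real.pi)).withDensity fun θ =>
          ENNReal.ofReal (2 * s * Real.sin θ * d (c + 2 * s * Real.cos θ))).map
            fun θ => c + 2 * s * Real.cos θ := by
  let x : ℝ → ℝ := fun θ => c + 2 * s * Real.cos θ
  have hx : Measurable x := by fun_prop
  have himage : x '' Set.Icc 0 Real.pi = Set.Icc (c - 2 * s) (c + 2 * s) := by
    have : x = (fun y => c + 2 * s * y) ∘ Real.cos := rfl
    rw [this, Set.image_comp, Real.bijOn_cos.image_eq]
    have h2 : (fun y => c + 2 * s * y) = (fun y => y + c) ∘ fun y => 2 * s * y := by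
      funext y; simp [add_comm]
    rw [h2, Set.image_comp, Set.image_mul_left_Icc' (by positivity), Set.image_add_const_Icc]
    congr 1 <;> ring
  have hinj : Set.InjOn x (Set.Icc 0 Real.pi) := fun a ha b hb hab =>
    Real.injOn_cos ha hb (by
      have : 2 * s * Real.cos a = 2 * s * Real.cos b := by simpa [x] using hab
      exact mul_left_cancel₀ (by positivity) this)
  have hderiv : ∀ θ ∈ Set.Icc 0 Real.pi,
      HasDerivWithinAt x (2 * s * (-Real.sin θ)) (Set.Icc 0 Real.pi) θ := fun θ _ =>
    (((Real.hasDerivAt_cos θ).const_mul (2 * s)).const_add c).hasDerivWithinAt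
  ext B hB
  rw [withDensity_apply _ hB, Measure.map_apply hx hB, withDensity_apply _ (hx hB),
    ← lintegral_indicator hB, ← lintegral_indicator (hx hB), ← himage,
    lintegral_image_eq_lintegral_abs_deriv_mul measurableSet_Icc hderiv hinj]
  refine setLIntegral_congr_fun measurableSet_Icc fun θ hθ => ?_
  have hsin := Real.sin_nonneg_of_nonneg_of_le_pi hθ.1 hθ.2
  have habs : |2 * s * -Real.sin θ| = 2 * s * Real.sin θ := by
    rw [mul_neg, abs_neg, abs_of_nonneg (by positivity)]
  rw [habs]
  by_cases hB' : x θ ∈ B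
  · rw [Set.indicator_of_mem hB', Set.indicator_of_mem (Set.mem_preimage.2 hB'),
      ← ENNReal.ofReal_mul (by positivity)]
  · rw [Set.indicator_of_notMem hB', Set.indicator_of_notMem (mt Set.mem_preimage.1 hB'),
      mul_zero]

theorem semicircleLaw_eq_map : semicircleLaw
    = ((volume.restrict (Set.Icc 0 Real.pi)).withDensity fun θ =>
        ENNReal.ofReal (2 / Real.pi * Real.sin θ ^ 2)).map fun θ => 2 * Real.cos θ := by
  have h := withDensity_Icc_eq_map_cos 0 one_pos fun x => Real.sqrt (4 - x ^ 2) / (2 * Real.pi)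
  simp only [mul_one, zero_sub, zero_add] at h
  rw [semicircleLaw, h]
  congr 1
  refine withDensity_congr_ae ?_
  filter_upwards [ae_restrict_mem measurableSet_Icc] with θ hθ
  have hsin := Real.sin_nonneg_of_nonneg_of_le_pi hθ.1 hθ.2
  have : 4 - (2 * Real.cos θ) ^ 2 = (2 * Real.sin θ) ^ 2 := by
    linear_combination (-4) * Real.sin_sq_add_cos_sq θ
  rw [this, Real.sqrt_sq (by positivity)]
  congr 1
  field_simp

/-- The integral of a function against a measure given in terms of the angle. -/
theorem integral_map_withDensity_angle {x w : ℝ → ℝ} (hx : Measurable x) (hw : Measurable w)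
    (hw0 : ∀ θ, 0 ≤ w θ) {f : ℝ → ℝ} (hf : Continuous f) :
    ∫ t, f t ∂(((volume.restrict (Set.Icc 0 Real.pi)).withDensity fun θ =>
        ENNReal.ofReal (w θ)).map x) = ∫ θ in 0..Real.pi, w θ * f (x θ) := by
  rw [integral_map hx.aemeasurable hf.aestronglyMeasurable,
    integral_withDensity_eq_integral_toReal_smul (by fun_prop) (.of_forall fun _ => by simp),
    intervalIntegral.integral_of_le Real.pi_pos.le, integral_Icc_eq_integral_Ioc]
  simp [ENNReal.toReal_ofReal, hw0]

theorem integral_semicircleLaw {f : ℝ → ℝ} (hf : Continuous f) :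
    ∫ t, f t ∂semicircleLaw
      = ∫ θ in 0..Real.pi, 2 / Real.pi * Real.sin θ ^ 2 * f (2 * Real.cos θ) := by
  rw [semicircleLaw_eq_map, integral_map_withDensity_angle (by fun_prop) (by fun_prop)
    (fun θ => by positivity) hf]

/-- This controls the density at the left edge, where `1 + γ + 2 √γ cos θ` vanishes if `γ = 1`. -/
theorem mul_sin_sq_le {γ : ℝ} (hγ : 0 < γ) (θ : ℝ) :
    γ * Real.sin θ ^ 2 ≤ 1 + γ + 2 * √γ * Real.cos θ := by
  have h := Real.sq_sqrt hγ.le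
  nlinarith [sq_nonneg (1 + √γ * Real.cos θ), Real.sin_sq_add_cos_sq θ]

/-- The density of the absolutely continuous part of the Marchenko–Pastur law in terms of the
angle. -/
noncomputable def marchenkoPasturWeight (γ θ : ℝ) : ℝ :=
  2 / Real.pi * Real.sin θ ^ 2 / (1 + γ + 2 * √γ * Real.cos θ)

theorem marchenkoPasturWeight_nonneg {γ : ℝ} (hγ : 0 < γ) (θ : ℝ) :
    0 ≤ marchenkoPasturWeight γ θ :=
  div_nonneg (by positivity) ((by positivity : 0 ≤ γ * Real.sin θ ^ 2).trans (mul_sin_sq_le hγ θ))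

theorem measurable_marchenkoPasturWeight (γ : ℝ) : Measurable (marchenkoPasturWeight γ) := by
  unfold marchenkoPasturWeight
  fun_prop

theorem marchenkoPasturWeight_mul {γ : ℝ} (hγ : 0 < γ) (θ : ℝ) :
    marchenkoPasturWeight γ θ * (1 + γ + 2 * √γ * Real.cos θ) = 2 / Real.pi * Real.sin θ ^ 2 := by
  -- where the denominator vanishes, so does the numerator
  refine div_mul_cancel_of_imp fun h => ?_
  have h1 := mul_sin_sq_le hγ θ
  rw [h] at h1
  have : Real.sin θ ^ 2 = 0 :=
    le_antisymm (nonpos_of_mul_nonpos_right h1 hγ) (sq_nonneg _)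
  rw [this, mul_zero]

theorem marchenkoPasturWeight_le {γ : ℝ} (hγ : 0 < γ) (θ : ℝ) :
    marchenkoPasturWeight γ θ ≤ 2 / Real.pi / γ := by
  refine div_le_of_le_mul₀ ((by positivity : 0 ≤ γ * Real.sin θ ^ 2).trans (mul_sin_sq_le hγ θ))
    (by positivity) ?_
  have h := mul_le_mul_of_nonneg_left (mul_sin_sq_le hγ θ)
    (by positivity : 0 ≤ 2 / Real.pi / γ)
  refine le_trans (le_of_eq ?_) h
  field_simp

theorem marchenkoPasturLaw_eq {γ : ℝ} (hγ : 0 < γ) : marchenkoPasturLaw γ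
    = ENNReal.ofReal (1 - 1 / γ) • Measure.dirac 0
      + ((volume.restrict (Set.Icc 0 Real.pi)).withDensity fun θ =>
          ENNReal.ofReal (marchenkoPasturWeight γ θ)).map
            fun θ => 1 + γ + 2 * √γ * Real.cos θ := by
  have hs : 0 < √γ := Real.sqrt_pos.2 hγ
  have hsq := Real.sq_sqrt hγ.le
  rw [marchenkoPasturLaw]
  congr 1
  have e1 : (1 - √γ) ^ 2 = 1 + γ - 2 * √γ := by linear_combination hsq
  have e2 : (1 + √γ) ^ 2 = 1 + γ + 2 * √γ := by linear_combination hsq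
  rw [e1, e2, withDensity_Icc_eq_map_cos (1 + γ) hs]
  congr 1
  refine withDensity_congr_ae ?_
  filter_upwards [ae_restrict_mem measurableSet_Icc] with θ hθ
  have hsin := Real.sin_nonneg_of_nonneg_of_le_pi hθ.1 hθ.2
  have : (1 + γ + 2 * √γ - (1 + γ + 2 * √γ * Real.cos θ))
      * (1 + γ + 2 * √γ * Real.cos θ - (1 + γ - 2 * √γ)) = (2 * √γ * Real.sin θ) ^ 2 := by
    linear_combination (-4 * √γ ^ 2) * Real.sin_sq_add_cos_sq θ
  rw [this, Real.sqrt_sq (by positivity), marchenkoPasturWeight]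
  congr 1
  rw [mul_div_assoc', div_mul_eq_div_div, div_mul_eq_mul_div]
  congr 1
  field_simp
  rw [hsq]
  ring

theorem isFiniteMeasure_marchenkoPasturLaw {γ : ℝ} (hγ : 0 < γ) :
    IsFiniteMeasure (marchenkoPasturLaw γ) := by
  have : IsFiniteMeasure ((volume.restrict (Set.Icc 0 Real.pi)).withDensity fun θ =>
      ENNReal.ofReal (marchenkoPasturWeight γ θ)) := by
    refine isFiniteMeasure_withDensity_ofReal (Integrable.of_bound
      (measurable_marchenkoPasturWeight γ).aestronglyMeasurable (2 / Real.pi / γ)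
      (.of_forall fun θ => ?_)).2
    rw [Real.norm_of_nonneg (marchenkoPasturWeight_nonneg hγ θ)]
    exact marchenkoPasturWeight_le hγ θ
  have : IsFiniteMeasure (ENNReal.ofReal (1 - 1 / γ) • Measure.dirac (0 : ℝ)) :=
    Measure.smul_finite _ ENNReal.ofReal_ne_top
  rw [marchenkoPasturLaw_eq hγ]
  infer_instance

theorem isFiniteMeasure_semicircleLaw : IsFiniteMeasure semicircleLaw := by
  have : IsFiniteMeasure ((volume.restrict (Set.Icc 0 Real.pi)).withDensity fun θ =>
      ENNReal.ofReal (2 / Real.pi * Real.sin θ ^ 2)) :=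
    isFiniteMeasure_withDensity_ofReal
      ((Continuous.integrableOn_Icc (by fun_prop)) : IntegrableOn _ _ _).2
  rw [semicircleLaw_eq_map]
  infer_instance

theorem isCompact_support_of_measure_compl_eq_zero {μ : Measure ℝ} {K : Set ℝ} (hK : IsCompact K)
    (h : μ Kᶜ = 0) : IsCompact μ.support :=
  hK.of_isClosed_subset Measure.isClosed_support
    (Measure.support_subset_of_isClosed hK.isClosed (mem_ae_iff.2 h))

theorem semicircleLaw_compl_Icc : semicircleLaw (Set.Icc (-2) 2)ᶜ = 0 :=
  withDensity_absolutelyContinuous _ _ (by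
    rw [Measure.restrict_apply measurableSet_Icc.compl]; simp)

theorem exists_isCompact_marchenkoPasturLaw_compl (γ : ℝ) :
    ∃ K : Set ℝ, IsCompact K ∧ marchenkoPasturLaw γ Kᶜ = 0 := by
  have hI : MeasurableSet (Set.Icc ((1 - √γ) ^ 2) ((1 + √γ) ^ 2)) := measurableSet_Icc
  refine ⟨{0} ∪ Set.Icc ((1 - √γ) ^ 2) ((1 + √γ) ^ 2), isCompact_singleton.union isCompact_Icc, ?_⟩
  rw [marchenkoPasturLaw, Measure.add_apply, add_eq_zero]
  constructor
  · simp
  · refine withDensity_absolutelyContinuous _ _ ?_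
    rw [Measure.restrict_apply ((measurableSet_singleton _).union hI).compl, Set.compl_union,
      Set.inter_assoc, Set.compl_inter_self, Set.inter_empty, measure_empty]

theorem integral_marchenkoPasturLaw {γ : ℝ} (hγ : 0 < γ) {f : ℝ → ℝ} (hf : Continuous f) :
    ∫ t, f t ∂marchenkoPasturLaw γ = max (1 - 1 / γ) 0 * f 0
      + ∫ θ in 0..Real.pi,
          marchenkoPasturWeight γ θ * f (1 + γ + 2 * √γ * Real.cos θ) := by
  have := isFiniteMeasure_marchenkoPasturLaw hγ
  obtain ⟨K, hK, hK0⟩ := exists_isCompact_marchenkoPasturLaw_compl γ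
  have hint := Measure.integrable_of_isCompact_support
    (isCompact_support_of_measure_compl_eq_zero hK hK0) hf
  rw [marchenkoPasturLaw_eq hγ] at hint ⊢
  rw [integrable_add_measure] at hint
  rw [integral_add_measure hint.1 hint.2, integral_smul_measure, integral_dirac,
    integral_map_withDensity_angle (by fun_prop) (measurable_marchenkoPasturWeight γ)
      (marchenkoPasturWeight_nonneg hγ) hf]
  simp [ENNReal.toReal_ofReal']

/-- The positive moments of the Marchenko–Pastur law are moments of an affine image of the
semicircle law. -/
theorem integral_pow_succ_marchenkoPasturLaw {γ : ℝ} (hγ : 0 < γ) (n : ℕ) :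
    ∫ t, t ^ (n + 1) ∂marchenkoPasturLaw γ = ∫ t, (1 + γ + √γ * t) ^ n ∂semicircleLaw := by
  rw [integral_marchenkoPasturLaw hγ (by fun_prop), integral_semicircleLaw (by fun_prop)]
  simp only [ne_eq, Nat.add_eq_zero_iff, one_ne_zero, and_false, not_false_eq_true, zero_pow,
    mul_zero, zero_add]
  refine intervalIntegral.integral_congr fun θ _ => ?_
  rw [pow_succ', ← mul_assoc, marchenkoPasturWeight_mul hγ]
  ring

/-- The integral of the Poisson kernel over a half circle. -/
theorem integral_poisson_half {r R : ℝ} (hr : 0 ≤ r) (hrR : r < R) :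
    ∫ θ in 0..Real.pi, (R ^ 2 + r ^ 2 + 2 * (R * r) * Real.cos θ)⁻¹
      = Real.pi / (R ^ 2 - r ^ 2) := by
  have hR : 0 < R := hr.trans_lt hrR
  have hd : 0 < R ^ 2 - r ^ 2 := by nlinarith
  let F : ℝ → ℝ := fun θ => (R ^ 2 + r ^ 2 + 2 * (R * r) * Real.cos θ)⁻¹
  have hpos : ∀ θ, 0 < R ^ 2 + r ^ 2 + 2 * (R * r) * Real.cos θ := fun θ => by
    nlinarith [Real.neg_one_le_cos θ, mul_nonneg hR.le hr, sq_pos_of_pos (sub_pos.2 hrR)]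
  have hF : Continuous F := Continuous.inv₀ (by fun_prop) fun θ => (hpos θ).ne'
  have hw : (-(r : ℂ)) ∈ Metric.ball (0 : ℂ) R := by
    simpa [abs_of_nonneg hr] using hrR
  have key := DiffContOnCl.circleAverage_poissonKernel_smul' (f := fun _ : ℂ => (1 : ℂ))
    (diffContOnCl_const) hw
  rw [Real.circleAverage_def] at key
  have hnorm : ∀ θ : ℝ, ((‖circleMap 0 R θ - 0‖ ^ 2 - ‖(-(r : ℂ)) - 0‖ ^ 2)
      / ‖(circleMap 0 R θ - 0) - ((-(r : ℂ)) - 0)‖ ^ 2) • (1 : ℂ)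
        = (((R ^ 2 - r ^ 2) * F θ : ℝ) : ℂ) := fun θ => by
    have h1 : ‖(circleMap 0 R θ - 0) - ((-(r : ℂ)) - 0)‖ ^ 2
        = R ^ 2 + r ^ 2 + 2 * (R * r) * Real.cos θ := by
      rw [Complex.sq_norm, Complex.normSq_apply]
      simp [circleMap, Complex.exp_re, Complex.exp_im]
      linear_combination R ^ 2 * Real.sin_sq_add_cos_sq θ
    rw [h1]
    simp [F, div_eq_mul_inv]
  simp only [hnorm] at key
  rw [intervalIntegral.integral_ofReal, intervalIntegral.integral_const_mul] at key
  have key' : (2 * Real.pi)⁻¹ * ((R ^ 2 - r ^ 2) * ∫ θ in 0..2 * Real.pi, F θ) = 1 := by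
    rw [Complex.real_smul] at key
    exact_mod_cast key
  have hsplit : ∫ θ in 0..2 * Real.pi, F θ
      = (∫ θ in 0..Real.pi, F θ) + ∫ θ in Real.pi..2 * Real.pi, F θ :=
    (intervalIntegral.integral_add_adjacent_intervals (hF.intervalIntegrable _ _)
      (hF.intervalIntegrable _ _)).symm
  have hrefl : ∫ θ in Real.pi..2 * Real.pi, F θ = ∫ θ in 0..Real.pi, F θ := by
    have := intervalIntegral.integral_comp_sub_left (a := 0) (b := Real.pi) F (2 * Real.pi)
    rw [sub_zero, show 2 * Real.pi - Real.pi = Real.pi by ring] at this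
    rw [← this]
    refine intervalIntegral.integral_congr fun θ _ => ?_
    simp [F, Real.cos_two_pi_sub]
  rw [hsplit, hrefl] at key'
  change ∫ θ in 0..Real.pi, F θ = _
  have := Real.pi_pos
  field_simp at key' ⊢
  linear_combination key' / 2

/-- The total mass of the absolutely continuous part of the Marchenko–Pastur law. -/
theorem integral_marchenkoPasturWeight {γ : ℝ} (hγ : 0 < γ) :
    ∫ θ in 0..Real.pi, marchenkoPasturWeight γ θ = (1 + γ - |1 - γ|) / (2 * γ) := by
  have hs : 0 < √γ := Real.sqrt_pos.2 hγ
  have hsq := Real.sq_sqrt hγ.le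
  have hpi := Real.pi_pos
  -- division of `4 γ sin² θ` by `1 + γ + 2 √γ cos θ`
  have hdiv : ∀ θ, 1 + γ + 2 * √γ * Real.cos θ ≠ 0 →
      marchenkoPasturWeight γ θ = (2 * Real.pi * γ)⁻¹ * ((1 + γ - 2 * √γ * Real.cos θ)
        - (1 - γ) ^ 2 * (1 + γ + 2 * √γ * Real.cos θ)⁻¹) := fun θ h => by
    rw [marchenkoPasturWeight]
    field_simp
    linear_combination 4 * γ * Real.sin_sq_add_cos_sq θ + 4 * Real.cos θ ^ 2 * hsq
  let F : ℝ → ℝ := fun θ => (1 + γ + 2 * √γ * Real.cos θ)⁻¹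
  have hF : IntervalIntegrable (fun θ => (1 - γ) ^ 2 * F θ) volume 0 Real.pi ∧
      ∫ θ in 0..Real.pi, (1 - γ) ^ 2 * F θ = |1 - γ| * Real.pi := by
    rcases eq_or_ne γ 1 with rfl | h1
    · simp
    have hpos : ∀ θ, 1 + γ + 2 * √γ * Real.cos θ ≠ 0 := fun θ h0 => by
      have hs1 : √γ ≠ 1 := by rwa [Ne, Real.sqrt_eq_one]
      have : 0 < (1 - √γ) ^ 2 := by
        have := sub_ne_zero.2 hs1.symm
        positivity
      nlinarith [Real.neg_one_le_cos θ]
    refine ⟨(Continuous.inv₀ (by fun_prop) hpos).const_mul _ |>.intervalIntegrable _ _, ?_⟩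
    rw [intervalIntegral.integral_const_mul]
    rcases lt_or_gt_of_ne h1 with h1 | h1
    · have h := integral_poisson_half hs.le ((Real.sqrt_lt' one_pos).2 (by simpa using h1))
      rw [one_pow, one_mul, hsq] at h
      rw [h, abs_of_pos (sub_pos.2 h1)]
      have := (sub_pos.2 h1).ne'
      field_simp
    · have h := integral_poisson_half zero_le_one (Real.lt_sqrt_of_sq_lt (by simpa using h1))
      rw [one_pow, mul_one, hsq, add_comm γ 1] at h
      rw [h, abs_of_neg (sub_neg.2 h1)]
      have := (sub_pos.2 h1).ne'
      field_simp
      ring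
  -- for `γ = 1` the division fails at `θ = π`, a null set
  have hcongr : ∫ θ in 0..Real.pi, marchenkoPasturWeight γ θ
      = ∫ θ in 0..Real.pi, (2 * Real.pi * γ)⁻¹ *
          ((1 + γ - 2 * √γ * Real.cos θ) - (1 - γ) ^ 2 * F θ) := by
    refine intervalIntegral.integral_congr_ae ?_
    filter_upwards [compl_mem_ae_iff.2 (measure_singleton Real.pi)] with θ hθ hmem
    rw [Set.uIoc_of_le hpi.le] at hmem
    have hsin := Real.sin_pos_of_pos_of_lt_pi hmem.1 (lt_of_le_of_ne hmem.2 hθ)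
    exact hdiv θ ((by positivity : 0 < γ * Real.sin θ ^ 2).trans_le (mul_sin_sq_le hγ θ)).ne'
  rw [hcongr, intervalIntegral.integral_const_mul, intervalIntegral.integral_sub
    (Continuous.intervalIntegrable (by fun_prop) _ _) hF.1, hF.2, intervalIntegral.integral_sub
    (Continuous.intervalIntegrable (by fun_prop) _ _)
    (Continuous.intervalIntegrable (by fun_prop) _ _), intervalIntegral.integral_const_mul,
    integral_cos, intervalIntegral.integral_const]
  simp only [Real.sin_pi, Real.sin_zero, sub_self, mul_zero, sub_zero, smul_eq_mul]
  field_simp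

theorem isProbabilityMeasure_marchenkoPasturLaw {γ : ℝ} (hγ : 0 < γ) :
    IsProbabilityMeasure (marchenkoPasturLaw γ) := by
  have := isFiniteMeasure_marchenkoPasturLaw hγ
  have h := integral_marchenkoPasturLaw hγ (f := fun _ => 1) continuous_const
  simp only [mul_one, integral_marchenkoPasturWeight hγ, integral_const, smul_eq_mul] at h
  refine ⟨?_⟩
  rw [← ENNReal.toReal_eq_one_iff, ← Measure.real, h]
  rcases le_total γ 1 with h1 | h1
  · rw [max_eq_right (sub_nonpos.2 ((one_le_div hγ).2 h1)), abs_of_nonneg (sub_nonneg.2 h1)]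
    field_simp
    ring
  · rw [max_eq_left (sub_nonneg.2 ((div_le_one hγ).2 h1)), abs_of_nonpos (sub_nonpos.2 h1)]
    field_simp
    ring

end Laws

/-! ### Moments of the summands in the Fock space -/

section Moments

open MeasureTheory

theorem integral_cos_nat_mul {k : ℕ} (hk : k ≠ 0) :
    ∫ θ in 0..Real.pi, Real.cos (k * θ) = 0 := by
  have hk' : (k : ℝ) ≠ 0 := Nat.cast_ne_zero.2 hk
  rw [intervalIntegral.integral_comp_mul_left (fun t => Real.cos t) hk', integral_cos,
    Real.sin_nat_mul_pi]
  simp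

/-- The Chebyshev polynomials `S n` are orthogonal to `S 0 = 1` for the semicircle law. -/
theorem integral_chebyshevS_semicircleLaw (n : ℕ) :
    ∫ t, (Polynomial.Chebyshev.S ℝ n).eval t ∂semicircleLaw = if n = 0 then 1 else 0 := by
  rw [integral_semicircleLaw (Polynomial.continuous _)]
  have h : ∀ θ, 2 / Real.pi * Real.sin θ ^ 2
      * (Polynomial.Chebyshev.S ℝ n).eval (2 * Real.cos θ)
        = Real.pi⁻¹ * (Real.cos (n * θ) - Real.cos ((n + 2 : ℕ) * θ)) := fun θ => by
    have h1 := Polynomial.Chebyshev.S_two_mul_real_cos θ n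
    have h2 : Real.cos (n * θ) - Real.cos ((n + 2 : ℕ) * θ)
        = 2 * Real.sin θ * Real.sin ((n + 1) * θ) := by
      have e1 : (n : ℝ) * θ = (n + 1) * θ - θ := by ring
      have e2 : ((n + 2 : ℕ) : ℝ) * θ = (n + 1) * θ + θ := by push_cast; ring
      rw [e1, e2, Real.cos_sub, Real.cos_add]
      ring
    rw [h2]
    push_cast at h1
    rw [← h1]
    ring
  simp only [h]
  rw [intervalIntegral.integral_const_mul, intervalIntegral.integral_sub
    (Continuous.intervalIntegrable (by fun_prop) _ _)
    (Continuous.intervalIntegrable (by fun_prop) _ _), integral_cos_nat_mul (k := n + 2) (by omega)]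
  split_ifs with hn
  · subst hn
    simp [Real.pi_ne_zero]
  · rw [integral_cos_nat_mul hn]
    simp

theorem span_chebyshevS : Submodule.span ℝ
    (Set.range fun n : ℕ => Polynomial.Chebyshev.S ℝ n) = ⊤ := by
  set W := Submodule.span ℝ (Set.range fun n : ℕ => Polynomial.Chebyshev.S ℝ n)
  have hS : ∀ n : ℕ, Polynomial.Chebyshev.S ℝ n ∈ W := fun n => Submodule.subset_span ⟨n, rfl⟩
  have hX : ∀ p ∈ W, Polynomial.X * p ∈ W := by
    intro p hp
    induction hp using Submodule.span_induction with
    | zero => simp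
    | add p q _ _ hp hq => rw [mul_add]; exact W.add_mem hp hq
    | smul c p _ hp => rw [mul_smul_comm]; exact W.smul_mem c hp
    | mem p hp =>
      obtain ⟨n, rfl⟩ := hp
      rcases n with _ | n
      · simpa using hS 1
      · have h := Polynomial.Chebyshev.S_add_two ℝ n
        have e : Polynomial.X * Polynomial.Chebyshev.S ℝ ((n + 1 : ℕ) : ℤ)
            = Polynomial.Chebyshev.S ℝ ((n + 2 : ℕ) : ℤ) + Polynomial.Chebyshev.S ℝ n := by
          push_cast
          rw [h]
          ring
        change Polynomial.X * Polynomial.Chebyshev.S ℝ ((n + 1 : ℕ) : ℤ) ∈ W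
        rw [e]
        exact W.add_mem (hS _) (hS _)
  rw [eq_top_iff]
  intro p _
  induction p using Polynomial.induction_on' with
  | add p q hp hq => exact W.add_mem (hp trivial) (hq trivial)
  | monomial n c =>
    induction n with
    | zero =>
      have := W.smul_mem c (hS 0)
      simpa [Polynomial.smul_eq_C_mul] using this
    | succ n ih =>
      rw [← Polynomial.X_mul_monomial]
      exact hX _ (ih trivial)

theorem aeval_eq_integral_of_moments {A : Type*} [CStarAlgebra A] {φ : A →ₗ[ℂ] ℂ} {a : A}
    {μ : Measure ℝ} [IsFiniteMeasure μ] (hμ : IsCompact μ.support)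
    (h : ∀ n : ℕ, φ (a ^ n) = ((∫ t, t ^ n ∂μ : ℝ) : ℂ)) (p : Polynomial ℝ) :
    φ (Polynomial.aeval a p) = ((∫ t, p.eval t ∂μ : ℝ) : ℂ) := by
  induction p using Polynomial.induction_on' with
  | add p q hp hq =>
    simp only [map_add, Polynomial.eval_add]
    rw [integral_add (Measure.integrable_of_isCompact_support hμ p.continuous)
      (Measure.integrable_of_isCompact_support hμ q.continuous), hp, hq, Complex.ofReal_add]
  | monomial n c =>
    rw [Polynomial.aeval_monomial, ← Algebra.smul_def, ← Complex.coe_smul, map_smul, h]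
    simp only [Polynomial.eval_monomial]
    rw [integral_const_mul]
    simp

theorem isCompact_support_semicircleLaw : IsCompact semicircleLaw.support :=
  isCompact_support_of_measure_compl_eq_zero isCompact_Icc semicircleLaw_compl_Icc

theorem isCompact_support_marchenkoPasturLaw (γ : ℝ) : IsCompact (marchenkoPasturLaw γ).support :=
  let ⟨_, hK, hK0⟩ := exists_isCompact_marchenkoPasturLaw_compl γ
  isCompact_support_of_measure_compl_eq_zero hK hK0

theorem isProbabilityMeasure_semicircleLaw : IsProbabilityMeasure semicircleLaw := by
  have := isFiniteMeasure_semicircleLaw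
  have h := integral_chebyshevS_semicircleLaw 0
  simp only [Nat.cast_zero, Polynomial.Chebyshev.S_zero, Polynomial.eval_one, integral_const,
    smul_eq_mul, mul_one, if_true] at h
  exact ⟨by rw [← ENNReal.toReal_eq_one_iff, ← Measure.real, h]⟩

/-- The law of a polynomial in an element whose law is known. -/
theorem HasSpectralLaw.map_polynomial {A : Type*} [CStarAlgebra A] {φ : A →ₗ[ℂ] ℂ} {a : A}
    {μ : Measure ℝ} (h : HasSpectralLaw φ a μ) (p : Polynomial ℝ) :
    HasSpectralLaw φ (Polynomial.aeval a p) (μ.map fun t => p.eval t) := by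
  have := h.isProbabilityMeasure
  have hp : Continuous fun t => p.eval t := p.continuous
  refine ⟨?_, Measure.isProbabilityMeasure_map hp.aemeasurable, ?_, fun n => ?_⟩
  · rw [Polynomial.aeval_eq_sum_range]
    exact isSelfAdjoint_sum _ fun i _ => (IsSelfAdjoint.all _).smul (h.isSelfAdjoint.pow i)
  · have hK := h.isCompact_support.image hp
    refine isCompact_support_of_measure_compl_eq_zero hK ?_
    rw [Measure.map_apply hp.measurable hK.measurableSet.compl]
    refine measure_mono_null (fun t ht hts => ht ⟨t, hts, rfl⟩) Measure.measure_compl_support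
  · rw [integral_map hp.aemeasurable (by fun_prop), ← map_pow,
      aeval_eq_integral_of_moments h.isCompact_support h.moment]
    simp

variable {H : Type*} [NormedAddCommGroup H] [InnerProductSpace ℂ H] [CompleteSpace H]
  {κ : Type*} [DecidableEq κ] {l r : κ → H →L[ℂ] H} {Ω : H}

theorem IsFockRepresentation.aeval_chebyshevS_apply_vacuum (h : IsFockRepresentation l r Ω)
    (i : κ) (n : ℕ) :
    Polynomial.aeval (l i + star (l i)) (Polynomial.Chebyshev.S ℝ n) Ω = (l i ^ n) Ω := by
  induction n using Nat.twoStepInduction with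
  | zero => simp
  | one => simp [h.star_left_vacuum]
  | more n h0 h1 =>
    have e := Polynomial.Chebyshev.S_add_two ℝ n
    have e' : Polynomial.Chebyshev.S ℝ ((n + 2 : ℕ) : ℤ)
        = Polynomial.X * Polynomial.Chebyshev.S ℝ ((n + 1 : ℕ) : ℤ)
          - Polynomial.Chebyshev.S ℝ n := by
      push_cast
      exact e
    rw [e', map_sub, map_mul, sub_apply, mul_apply_eq_comp, h1, h0, Polynomial.aeval_X, add_apply,
      pow_succ' _ n, mul_apply_eq_comp, h.star_left_apply_left, if_pos rfl, pow_succ' _ (n + 1),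
      pow_succ' _ n]
    simp only [mul_apply_eq_comp]
    abel

/-- The sum of a creation operator and its adjoint has the semicircle law in the vacuum state. -/
theorem IsFockRepresentation.hasSpectralLaw_semicircle (h : IsFockRepresentation l r Ω) (i : κ) :
    HasSpectralLaw (vacuumState Ω) (l i + star (l i)) semicircleLaw := by
  have hprob := isProbabilityMeasure_semicircleLaw
  have hint : ∀ p : Polynomial ℝ, Integrable (fun t => p.eval t) semicircleLaw := fun p =>
    Measure.integrable_of_isCompact_support isCompact_support_semicircleLaw p.continuous
  have key : ∀ p : Polynomial ℝ, vacuumState Ω (Polynomial.aeval (l i + star (l i)) p)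
      = ((∫ t, p.eval t ∂semicircleLaw : ℝ) : ℂ) := by
    intro p
    have hp : p ∈ Submodule.span ℝ (Set.range fun n : ℕ => Polynomial.Chebyshev.S ℝ n) := by
      rw [span_chebyshevS]; trivial
    induction hp using Submodule.span_induction with
    | zero => simp
    | add p q _ _ hp hq =>
      simp only [map_add, Polynomial.eval_add]
      rw [integral_add (hint p) (hint q), hp, hq, Complex.ofReal_add]
    | smul c p _ hp =>
      simp only [map_smul, Polynomial.eval_smul]
      rw [← Complex.coe_smul, map_smul, hp, integral_smul]
      simp
    | mem p hp =>
      obtain ⟨n, rfl⟩ := hp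
      beta_reduce
      rw [vacuumState_apply, h.aeval_chebyshevS_apply_vacuum, integral_chebyshevS_semicircleLaw]
      rcases n with _ | n
      · simp [h.norm_vacuum]
      · rw [pow_succ', mul_apply_eq_comp, h.inner_vacuum_left]
        simp
  refine ⟨?_, hprob, isCompact_support_semicircleLaw, fun n => ?_⟩
  · rw [IsSelfAdjoint, star_add, star_star, add_comm]
  · simpa using key (Polynomial.X ^ n)

/-- The element `(1 + √γ l) (1 + √γ l⋆)`, for a creation operator `l`, has the Marchenko–Pastur
law in the vacuum state: its positive moments are those of `(1 + √γ l⋆) (1 + √γ l)`, shifted by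
one, and the latter element is `1 + γ + √γ (l + l⋆)`. -/
theorem IsFockRepresentation.hasSpectralLaw_marchenkoPastur (h : IsFockRepresentation l r Ω)
    (i : κ) {γ : ℝ} (hγ : 0 < γ) :
    HasSpectralLaw (vacuumState Ω)
      ((1 + ((√γ : ℝ) : ℂ) • l i) * (1 + ((√γ : ℝ) : ℂ) • star (l i))) (marchenkoPasturLaw γ) := by
  have hprob := isProbabilityMeasure_marchenkoPasturLaw hγ
  set b := 1 + ((√γ : ℝ) : ℂ) • l i with hb
  have hbstar : 1 + ((√γ : ℝ) : ℂ) • star (l i) = star b := by simp [hb]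
  rw [hbstar]
  refine ⟨IsSelfAdjoint.mul_star_self b, hprob, isCompact_support_marchenkoPasturLaw γ,
    fun n => ?_⟩
  rcases n with _ | n
  · simp [vacuumState_apply, h.norm_vacuum]
  have hpow : (b * star b) ^ (n + 1) = b * (star b * b) ^ n * star b := by
    induction n with
    | zero => simp
    | succ n ih => rw [pow_succ, ih, pow_succ (star b * b)]; simp only [mul_assoc]
  have hvac : star b Ω = Ω := by
    rw [← hbstar]
    simp [h.star_left_vacuum]
  have haff : star b * b = Polynomial.aeval (l i + star (l i))
      (Polynomial.C (1 + γ) + Polynomial.C √γ * Polynomial.X) := by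
    have h1 := h.star_left_mul_left i i
    rw [if_pos rfl] at h1
    have hsq : ((√γ : ℝ) : ℂ) * ((√γ : ℝ) : ℂ) = γ := by
      exact_mod_cast Real.mul_self_sqrt hγ.le
    rw [← hbstar, hb, mul_add, add_mul, add_mul, smul_mul_smul_comm, h1, hsq]
    simp only [map_add, map_mul, Polynomial.aeval_C, Polynomial.aeval_X,
      Algebra.algebraMap_eq_smul_one, smul_mul_assoc, one_mul, mul_one, ← Complex.coe_smul]
    push_cast
    module
  have hsc := h.hasSpectralLaw_semicircle i
  have := hsc.isProbabilityMeasure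
  rw [integral_pow_succ_marchenkoPasturLaw hγ, hpow, vacuumState_apply, mul_apply_eq_comp,
    mul_apply_eq_comp, hvac, ← ContinuousLinearMap.star_inner_left, hvac, haff, ← map_pow,
    ← vacuumState_apply, aeval_eq_integral_of_moments hsc.isCompact_support hsc.moment]
  simp

end Moments

/-! ### The Cheng–Singer measure as a free convolution -/

section ChengSinger

open MeasureTheory

theorem one_add_ofReal_mul_ne_zero (b : ℝ) {m : ℂ} (hm : 0 < m.im) : 1 + (b : ℂ) * m ≠ 0 := by
  intro h
  have hi := congrArg Complex.im h
  rw [Complex.add_im, Complex.im_ofReal_mul, Complex.one_im, zero_add, Complex.zero_im] at hi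
  have hb : b = 0 := (mul_eq_zero.1 hi).resolve_right hm.ne'
  simp [hb] at h

/-- For `m` in the upper half plane, the Cheng–Singer equation is a cubic equation. -/
theorem chengSingerEquation_iff {a ν γ σ : ℝ} (hγ : 0 < γ) (hσ : σ ^ 2 = γ * (ν - a ^ 2)) {z m : ℂ}
    (hm : 0 < m.im) :
    ChengSingerEquation a ν γ z m ↔
      (1 + ((a * γ : ℝ) : ℂ) * m) * (1 + z * m + (σ : ℂ) ^ 2 * m ^ 2)
        + ((a * √γ : ℝ) : ℂ) ^ 2 * m ^ 2 = 0 := by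
  have hm0 : m ≠ 0 := fun h => by simp [h] at hm
  have hd := one_add_ofReal_mul_ne_zero (a * γ) hm
  have hσ' : (σ : ℂ) ^ 2 = γ * (ν - a ^ 2) := by exact_mod_cast hσ
  have hsq : ((√γ : ℝ) : ℂ) ^ 2 = γ := by exact_mod_cast Real.sq_sqrt hγ.le
  rw [ChengSingerEquation, hσ']
  push_cast at hd ⊢
  rw [mul_pow, hsq]
  generalize hD : 1 + (a : ℂ) * γ * m = D at hd
  have hDm : (a : ℂ) * γ * m = D - 1 := by rw [← hD]; ring
  have e : -(1 / m) - (z + (a : ℂ) * (1 - 1 / D) + γ * (ν - a ^ 2) * m)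
      = -(D * (1 + z * m + γ * (ν - a ^ 2) * m ^ 2) + a ^ 2 * γ * m ^ 2) / (m * D) := by
    field_simp
    linear_combination (a : ℂ) * m * hDm
  rw [← sub_eq_zero, e, div_eq_zero_iff, neg_eq_zero, or_iff_left (mul_ne_zero hm0 hd)]

theorem IsChengSingerMeasure.ext {a ν γ : ℝ} {μ₁ μ₂ : Measure ℝ}
    (h₁ : IsChengSingerMeasure a ν γ μ₁) (h₂ : IsChengSingerMeasure a ν γ μ₂) : μ₁ = μ₂ := by
  have := h₁.isProbabilityMeasure
  have := h₂.isProbabilityMeasure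
  exact ext_of_stieltjesTransform fun z hz =>
    h₂.unique z hz _ (h₁.im_pos z hz) (h₁.equation z hz)

variable {H : Type u} [NormedAddCommGroup H] [InnerProductSpace ℂ H] [CompleteSpace H]
  {l r : Fin 2 → H →L[ℂ] H} {Ω : H}

/-- The law of `fockSum` in the vacuum state is the Cheng–Singer measure. -/
theorem IsFockRepresentation.exists_isChengSingerMeasure (h : IsFockRepresentation l r Ω)
    {a ν γ σ : ℝ} (hγ : 0 < γ) (hσ : σ ^ 2 = γ * (ν - a ^ 2)) :
    ∃ μ : Measure ℝ, HasSpectralLaw (vacuumState Ω) (fockSum l (a * √γ) (a * γ) σ) μ ∧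
      IsChengSingerMeasure a ν γ μ := by
  set X := fockSum l (a * √γ) (a * γ) σ with hXdef
  have hX : IsSelfAdjoint X := isSelfAdjoint_fockSum _ _ _ _
  obtain ⟨μ, hlaw, hcfc⟩ := (isState_vacuumState h.norm_vacuum).exists_hasSpectralLaw hX
  have hprob := hlaw.isProbabilityMeasure
  have hres : ∀ z : ℂ, 0 < z.im → ∃ R : H →L[ℂ] H, (∀ v, R (X v - z • v) = v) ∧
      (∀ v, X (R v) - z • R v = v) ∧ stieltjesTransform μ z = ⟪Ω, R Ω⟫_ℂ := fun z hz => by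
    have hunit : IsUnit (X - z • 1) := by
      have hz' : z ∉ spectrum ℂ X := fun hmem => by
        have := congrArg Complex.im (hX.mem_spectrum_eq_re hmem)
        rw [Complex.ofReal_im] at this
        exact hz.ne' this
      rw [spectrum.notMem_iff, Algebra.algebraMap_eq_smul_one] at hz'
      simpa using hz'.neg
    obtain ⟨⟨_, R, h1, h2⟩, rfl⟩ := hunit
    refine ⟨R, fun v => ?_, fun v => ?_, ?_⟩
    · simpa using congrArg (fun T : H →L[ℂ] H => T v) h2
    · simpa using congrArg (fun T : H →L[ℂ] H => T v) h1
    · rw [stieltjesTransform_eq_of_resolvent hX hcfc hz.ne' h2, vacuumState_apply]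
  have him : ∀ z : ℂ, 0 < z.im → 0 < (stieltjesTransform μ z).im := fun z hz => by
    obtain ⟨R, _, h2, h3⟩ := hres z hz
    rw [h3, hX.im_inner_of_sub_smul_eq (h2 Ω)]
    have : R Ω ≠ 0 := fun h0 => by
      have e := h2 Ω
      rw [h0, map_zero, smul_zero, sub_zero] at e
      have := h.norm_vacuum
      rw [← e, norm_zero] at this
      exact zero_ne_one this
    positivity
  refine ⟨μ, hlaw, hprob, him, fun z hz => ?_, fun z hz w hw hcs => ?_⟩
  · obtain ⟨R, h1, h2, h3⟩ := hres z hz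
    rw [chengSingerEquation_iff hγ hσ (him z hz), h3]
    exact h.vacuum_resolvent_equation _ _ _ h1 h2
  · obtain ⟨R, h1, _, h3⟩ := hres z hz
    rw [h3]
    exact h.eq_vacuum_resolvent _ _ _ hz hw ((chengSingerEquation_iff hγ hσ hw).1 hcs)
      (one_add_ofReal_mul_ne_zero _ hw) h1

/-- The two summands of `fockSum` are free. -/
theorem IsFockRepresentation.areFreeElements (h : IsFockRepresentation l r Ω) (α β σ : ℝ) :
    AreFreeElements (vacuumState Ω)
      ((α : ℂ) • (l 0 + star (l 0)) + (β : ℂ) • (l 0 * star (l 0)))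
      ((σ : ℂ) • (l 1 + star (l 1))) := by
  rw [areFreeElements_iff]
  convert! h.areFree ![(α : ℂ), (σ : ℂ)] ![(β : ℂ), 0] using 2 with i
  fin_cases i <;> simp

theorem IsFockRepresentation.hasSpectralLaw_left (h : IsFockRepresentation l r Ω) (a : ℝ) {γ : ℝ}
    (hγ : 0 < γ) :
    HasSpectralLaw (vacuumState Ω)
      (((a * √γ : ℝ) : ℂ) • (l 0 + star (l 0)) + ((a * γ : ℝ) : ℂ) • (l 0 * star (l 0)))
      ((marchenkoPasturLaw γ).map fun y => a * (y - 1)) := by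
  have hlaw := (h.hasSpectralLaw_marchenkoPastur 0 hγ).map_polynomial
    (Polynomial.C a * (Polynomial.X - 1))
  have hsq : ((√γ : ℝ) : ℂ) * ((√γ : ℝ) : ℂ) = γ := by
    exact_mod_cast Real.mul_self_sqrt hγ.le
  convert! hlaw using 1
  · simp only [map_mul, map_sub, map_one, Polynomial.aeval_C, Polynomial.aeval_X,
      Algebra.algebraMap_eq_smul_one, smul_mul_assoc, one_mul, ← Complex.coe_smul]
    rw [add_mul, one_mul, mul_add, mul_one, smul_mul_smul_comm, hsq]
    push_cast
    module
  · simp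

theorem IsFockRepresentation.hasSpectralLaw_right (h : IsFockRepresentation l r Ω) (σ : ℝ) :
    HasSpectralLaw (vacuumState Ω) ((σ : ℂ) • (l 1 + star (l 1)))
      (semicircleLaw.map fun y => σ * y) := by
  have hlaw := (h.hasSpectralLaw_semicircle 1).map_polynomial (Polynomial.C σ * Polynomial.X)
  convert! hlaw using 1
  · simp [Algebra.algebraMap_eq_smul_one]
  · simp

end ChengSinger

theorem proposition1p1 (a ν γ : ℝ) (hγ : 0 < γ) (hν : a ^ 2 ≤ ν) :
    (∃! μ : MeasureTheory.Measure ℝ, IsChengSingerMeasure a ν γ μ) ∧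
    ∀ μ : MeasureTheory.Measure ℝ,
      IsChengSingerMeasure a ν γ μ ↔
        IsFreeConvolution.{u}
          ((marchenkoPasturLaw γ).map fun y => a * (y - 1))
          (semicircleLaw.map fun y => Real.sqrt (γ * (ν - a ^ 2)) * y)
          μ := by
  obtain ⟨H, _, _, _, l, r, Ω, h⟩ := exists_isFockRepresentation.{u} (Fin 2)
  set σ := Real.sqrt (γ * (ν - a ^ 2)) with hσdef
  have hσ : σ ^ 2 = γ * (ν - a ^ 2) := Real.sq_sqrt (mul_nonneg hγ.le (sub_nonneg.2 hν))
  obtain ⟨μ₀, hlaw, hcs⟩ := h.exists_isChengSingerMeasure hγ hσ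
  have hstate := isState_vacuumState h.norm_vacuum
  have hfree := h.areFreeElements (a * √γ) (a * γ) σ
  have hx := h.hasSpectralLaw_left a hγ
  have hy := h.hasSpectralLaw_right σ
  refine ⟨⟨μ₀, hcs, fun μ hμ => hμ.ext hcs⟩, fun μ => ⟨fun hμ => ?_, ?_⟩⟩
  · obtain rfl : μ = μ₀ := hμ.ext hcs
    exact ⟨H →L[ℂ] H, inferInstance, vacuumState Ω, _, _, hstate, hfree, hx, hy, hlaw⟩
  · rintro ⟨A, _, φ, x, y, hφ, hxy, hx', hy', hlaw'⟩
    have := hlaw.isProbabilityMeasure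
    have := hlaw'.isProbabilityMeasure
    have hμ : μ = μ₀ := MeasureTheory.Measure.ext_of_moments hlaw'.isCompact_support
      hlaw.isCompact_support fun n => by
        have e := hxy.moment_add_eq hφ.map_one hstate.map_one hfree
          (fun n => (hx'.moment n).trans (hx.moment n).symm)
          (fun n => (hy'.moment n).trans (hy.moment n).symm) n
        rw [hlaw'.moment] at e
        exact Complex.ofReal_injective (e.trans (hlaw.moment n))
    rw [hμ]
    exact hcs
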